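/- **Theorem (Alternative).** Let $L>0$. Let $a\in L^\infty(0,L)$ satisfy $\alpha'\le a(x)\le\beta'$ for a.e. $x\in(0,L)$, for some constants $0<\alpha'<\beta'$; let $g\in L^2(0,L)$; and let $\phi:\mathbb R\to\mathbb R\cup\{+\infty\}$ be continuous with values in $\mathbb R\cup\{+\infty\}$, with $\phi(s)<+\infty$ for every $s\neq 0$ and $\phi(0)=+\infty$. Consider the problem, formally written as $$-\frac{d}{dx}\Big(a\,\frac{du}{dx}\Big)=-\frac{d\phi(u)}{dx}-\frac{dg}{dx}\ \text{ in }(0,L),\qquad u(0)=u(L)=0. \tag{S}$$ A weak solution of (S) is a function $u\in H^1_0(0,L)$ with $\phi(u)\in L^2(0,L)$ (in particular $\phi(u)$ is finite a.e.) for which the equation holds in $\mathcal D'(0,L)$. Here $H^1_0(0,L)$ is equipped with the norm $\|u\|_{H^1_0(0,L)}=\|u'\|_{L^2(0,L)}$. Let $0<\alpha<\beta$ and $c_0>0$ be constants, and let $(a_n,g_n,\phi_n)_{n\in\mathbb N}$ satisfy: * $a_n$ is measurable with $\alpha\le a_n(x)\le\beta$ for a.e. $x\in(0,L)$, and $a_n(x)\to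 a(x)$ for a.e. $x\in(0,L)$; * $g_n\in L^2(0,L)$, $\|g_n\|_{L^2(0,L)}\le c_0$, and $g_n\rightharpoonup g$ weakly in $L^2(0,L)$; * $\phi_n:\mathbb R\to\mathbb R$ is continuous, and $(\phi_n)$ is a reasonable approximation of $\phi$: whenever $s_n\to s$ in $\mathbb R$, one has $\phi_n(s_n)\to\phi(s)$ in $\mathbb R\cup\{+\infty\}$. Then the following hold. 1. For every $n$ there exists a classical weak solution $u_n$ of the approximating problem, that is, a function $u_n\in H^1_0(0,L)$ with $$\int_0^L a_n u_n' z'\,dx=\int_0^L\phi_n(u_n)z'\,dx+\int_0^L g_n z'\,dx\qquad\text{for all } z\in H^1_0(0,L),$$ and every such $u_n$ satisfies $\|u_n'\|_{L^2(0,L)}\le\frac1\alpha\|g_n\|_{L^2(0,L)}\le\frac{c_0}{\alpha}$. 2. Let $(u_n)$ be any sequence of such solutions, and let $(u_{n'})$ be any subsequence that converges weakly in $H^1_0(0,L)$ to some $u$. Then either $u\equiv 0$, or $u$ is a weak solution of (S), and these two cases exclude each other. Moreover, if $u\not\equiv0$, then the sequence $\phi_{n'}(u_{n'})$ is bounded in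 $L^2(0,L)$. -/

import Mathlib

open MeasureTheory Filter Topology Set
open scoped ENNReal ContDiff Distributions

noncomputable section

/-- The open interval `(0, L)` as an open subset of `ℝ`. -/
def openInterval (L : ℝ) : TopologicalSpace.Opens ℝ := ⟨Ioo 0 L, isOpen_Ioo⟩

/-- Lebesgue measure on `(0, L)`. -/
abbrev intervalMeasure (L : ℝ) : Measure ℝ := volume.restrict (Ioo 0 L)

/-- The Hilbert space `L²(0, L)` of real functions. -/
abbrev L2 (L : ℝ) : Type := Lp ℝ 2 (intervalMeasure L)

/-- `v` is the distributional derivative of `u` on `(0, L)`. Elements of `𝓓(openInterval L, ℝ)` are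
the smooth functions with compact support contained in `(0, L)`. -/
def IsWeakDeriv (L : ℝ) (u v : L2 L) : Prop :=
  ∀ ψ : 𝓓(openInterval L, ℝ),
    ∫ x in Ioo 0 L, u x * deriv ψ x = - ∫ x in Ioo 0 L, v x * ψ x

/-- `u` has a continuous representative on `[0, L]`, and it vanishes at `0` and at `L`. -/
def VanishesAtEnds (L : ℝ) (u : L2 L) : Prop :=
  ∃ w : ℝ → ℝ, ContinuousOn w (Icc 0 L) ∧ w 0 = 0 ∧ w L = 0 ∧ u =ᵐ[intervalMeasure L] w

theorem L2.integrable {L : ℝ} (u : L2 L) : Integrable u (intervalMeasure L) :=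
  (Lp.memLp u).integrable one_le_two

theorem L2.integrable_mul {L : ℝ} (u : L2 L) {f : ℝ → ℝ} (hf : Continuous f)
    (hc : HasCompactSupport f) : Integrable (fun x => u x * f x) (intervalMeasure L) := by
  obtain ⟨C, hC⟩ := hc.exists_bound_of_continuous hf
  exact (L2.integrable u).mul_bdd (c := C) hf.aestronglyMeasurable (ae_of_all _ hC)

theorem testFunction_continuous_deriv {L : ℝ} (ψ : 𝓓(openInterval L, ℝ)) :
    Continuous (deriv ψ) := ψ.contDiff.continuous_deriv (by simp)

/-- The functions of `H¹₀(0, L)`, realized as the pairs `(u, u')` where `u ∈ L²(0, L)` has the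
distributional derivative `u' ∈ L²(0, L)` and `u(0) = u(L) = 0`. -/
def H10Graph (L : ℝ) : Submodule ℝ (L2 L × L2 L) where
  carrier := {p | IsWeakDeriv L p.1 p.2 ∧ VanishesAtEnds L p.1}
  zero_mem' := by
    refine ⟨fun ψ => ?_, 0, continuousOn_const, rfl, rfl, Lp.coeFn_zero _ _ _⟩
    have h (f : ℝ → ℝ) : ∫ x in Ioo 0 L, (0 : L2 L) x * f x = 0 := by
      refine integral_eq_zero_of_ae ?_
      filter_upwards [Lp.coeFn_zero ℝ 2 (intervalMeasure L)] with x hx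
      rw [hx, Pi.zero_apply, zero_mul]
    exact (h _).trans (neg_eq_zero.2 (h _)).symm
  add_mem' := by
    rintro p q ⟨hp, w, hw, hw0, hwL, hpw⟩ ⟨hq, z, hz, hz0, hzL, hqz⟩
    refine ⟨fun ψ => ?_, w + z, hw.add hz, by simp [hw0, hz0], by simp [hwL, hzL], ?_⟩
    · have h (u v : L2 L) {f : ℝ → ℝ} (hf : Continuous f) (hc : HasCompactSupport f) :
          ∫ x in Ioo 0 L, (u + v) x * f x
            = (∫ x in Ioo 0 L, u x * f x) + ∫ x in Ioo 0 L, v x * f x := by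
        rw [← integral_add (L2.integrable_mul u hf hc) (L2.integrable_mul v hf hc)]
        refine integral_congr_ae ?_
        filter_upwards [Lp.coeFn_add u v] with x hx
        rw [hx, Pi.add_apply, add_mul]
      rw [Prod.fst_add, Prod.snd_add,
        h _ _ (testFunction_continuous_deriv ψ) ψ.hasCompactSupport.deriv,
        h _ _ ψ.continuous ψ.hasCompactSupport, hp ψ, hq ψ, neg_add]
    · filter_upwards [Lp.coeFn_add p.1 q.1, hpw, hqz] with x hx h1 h2
      simp only [Prod.fst_add, hx, Pi.add_apply, h1, h2]
  smul_mem' := by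
    rintro c p ⟨hp, w, hw, hw0, hwL, hpw⟩
    refine ⟨fun ψ => ?_, c • w, hw.const_smul c, by simp [hw0], by simp [hwL], ?_⟩
    · have h (u : L2 L) (f : ℝ → ℝ) :
          ∫ x in Ioo 0 L, (c • u) x * f x = c * ∫ x in Ioo 0 L, u x * f x := by
        rw [← integral_const_mul]
        refine integral_congr_ae ?_
        filter_upwards [Lp.coeFn_smul c u] with x hx
        rw [hx, Pi.smul_apply, smul_eq_mul, mul_assoc]
      rw [Prod.smul_fst, Prod.smul_snd, h, h, hp ψ, mul_neg]
    · filter_upwards [Lp.coeFn_smul c p.1, hpw] with x hx h1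
      simp only [Prod.smul_fst, hx, Pi.smul_apply, h1]

/-- The Sobolev space `H¹₀(0, L)`. -/
def H10 (L : ℝ) : Type := H10Graph L

namespace H10

instance (L : ℝ) : AddCommGroup (H10 L) := inferInstanceAs (AddCommGroup (H10Graph L))

instance (L : ℝ) : Module ℝ (H10 L) := inferInstanceAs (Module ℝ (H10Graph L))

/-- The underlying function `u` of an element of `H¹₀(0, L)`. -/
def val {L : ℝ} : H10 L →ₗ[ℝ] L2 L :=
  LinearMap.fst ℝ (L2 L) (L2 L) ∘ₗ (H10Graph L).subtype

/-- The derivative `u'` of an element of `H¹₀(0, L)`. -/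
def der {L : ℝ} : H10 L →ₗ[ℝ] L2 L :=
  LinearMap.snd ℝ (L2 L) (L2 L) ∘ₗ (H10Graph L).subtype

theorem isWeakDeriv {L : ℝ} (u : H10 L) : IsWeakDeriv L (val u) (der u) := u.2.1

theorem vanishesAtEnds {L : ℝ} (u : H10 L) : VanishesAtEnds L (val u) := u.2.2

end H10

/-- A smooth function with vanishing integral and compact support in `(0, L)` is the derivative of
a test function. -/
theorem exists_testFunction_deriv_eq {L : ℝ} {f : ℝ → ℝ} (hf : ContDiff ℝ ∞ f)
    {a b : ℝ} (ha : 0 < a) (hb : b < L) (hs : ∀ x, x ∉ Icc a b → f x = 0)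
    (h0 : ∫ x in a..b, f x = 0) : ∃ θ : 𝓓(openInterval L, ℝ), deriv θ = f := by
  let θ : ℝ → ℝ := fun x => ∫ t in a..x, f t
  have hd : ∀ x, HasDerivAt θ (f x) x := fun x =>
    intervalIntegral.integral_hasDerivAt_right (hf.continuous.intervalIntegrable _ _)
      (hf.continuous.stronglyMeasurableAtFilter _ _) hf.continuous.continuousAt
  have hde : deriv θ = f := funext fun x => (hd x).deriv
  have hθ : ContDiff ℝ ∞ θ := by
    rw [contDiff_infty_iff_deriv]
    exact ⟨fun x => (hd x).differentiableAt, by rwa [hde]⟩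
  have hz : ∀ x, x ∉ Icc a b → θ x = 0 := by
    intro x hx
    have hx' : x < a ∨ b < x := by
      by_contra! h
      exact hx h
    rcases hx' with hx' | hx'
    · have : EqOn f (fun _ => (0 : ℝ)) (Ioo x a) := fun t ht => hs t fun h => by
        linarith [h.1, ht.2]
      change ∫ t in a..x, f t = 0
      rw [intervalIntegral.integral_symm, intervalIntegral.integral_of_le hx'.le,
        integral_Ioc_eq_integral_Ioo, setIntegral_congr_fun measurableSet_Ioo this]
      simp
    · have : EqOn f (fun _ => (0 : ℝ)) (Ioc b x) := fun t ht => hs t fun h => by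
        linarith [h.2, ht.1]
      change ∫ t in a..x, f t = 0
      rw [← intervalIntegral.integral_add_adjacent_intervals
        (hf.continuous.intervalIntegrable a b) (hf.continuous.intervalIntegrable b x), h0,
        intervalIntegral.integral_of_le hx'.le, setIntegral_congr_fun measurableSet_Ioc this]
      simp
  have hts : tsupport θ ⊆ Icc a b :=
    closure_minimal (fun x hx => by_contra fun h => hx (hz x h)) isClosed_Icc
  refine ⟨⟨θ, hθ, HasCompactSupport.of_support_subset_isCompact isCompact_Icc
    ((subset_tsupport _).trans hts), hts.trans fun x hx => ?_⟩, hde⟩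
  exact ⟨ha.trans_le hx.1, hx.2.trans_lt hb⟩

/-- A function of `H¹₀(0, L)` whose derivative vanishes is zero. -/
theorem H10.der_injective (L : ℝ) : Function.Injective (H10.der : H10 L →ₗ[ℝ] L2 L) := by
  rw [injective_iff_map_eq_zero]
  intro u hu
  suffices hv : H10.val u = 0 from Subtype.ext (Prod.ext hv hu)
  obtain ⟨w, hw, hw0, -, huw⟩ := u.vanishesAtEnds
  rw [Lp.eq_zero_iff_ae_eq_zero]
  rcases le_or_gt L 0 with hL | hL
  · have h0 : intervalMeasure L = 0 := by simp [intervalMeasure, Ioo_eq_empty (not_lt.2 hL)]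
    exact eventually_bot.filter_mono (ae_eq_bot.2 h0).le
  have hort : ∀ θ : 𝓓(openInterval L, ℝ), ∫ x in Ioo 0 L, H10.val u x * deriv θ x = 0 := by
    intro θ
    rw [u.isWeakDeriv θ, hu, integral_congr_ae (g := fun _ => (0 : ℝ))]
    · simp
    · filter_upwards [Lp.coeFn_zero ℝ 2 (intervalMeasure L)] with x hx
      simp only [hx, Pi.zero_apply, zero_mul]
  let B : ContDiffBump (L / 2) := ⟨L / 8, L / 4, by linarith, by linarith⟩
  let β : ℝ → ℝ := B.normed volume
  have hβ : ContDiff ℝ ∞ β := B.contDiff_normed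
  have hβc : HasCompactSupport β := B.hasCompactSupport_normed
  have hβs : tsupport β ⊆ Ioo 0 L := by
    rw [show tsupport β = Metric.closedBall (L / 2) (L / 4) from B.tsupport_normed_eq,
      Real.closedBall_eq_Icc]
    intro x hx
    exact ⟨by linarith [hx.1], by linarith [hx.2]⟩
  have hβ1 : ∫ x, β x = 1 := B.integral_normed
  set k : ℝ := ∫ x in Ioo 0 L, H10.val u x * β x with hk
  have hconst : ∀ᵐ x, x ∈ Ioo 0 L → H10.val u x - k = 0 := by
    apply isOpen_Ioo.ae_eq_zero_of_integral_contDiff_smul_eq_zero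
    · have : IntegrableOn (fun x => H10.val u x - k) (Ioo 0 L) volume :=
        (L2.integrable (H10.val u)).sub (integrable_const k)
      exact this.locallyIntegrableOn
    · intro ψ hψ hψc hψs
      let c : ℝ := ∫ x, ψ x
      let f : ℝ → ℝ := fun x => ψ x - c * β x
      have hf : ContDiff ℝ ∞ f := hψ.sub (contDiff_const.mul hβ)
      have hK : IsCompact (tsupport ψ ∪ tsupport β) :=
        IsCompact.union hψc hβc
      have hne : (tsupport ψ ∪ tsupport β).Nonempty := by
        refine Nonempty.inr ?_
        rw [show tsupport β = Metric.closedBall (L / 2) (L / 4) from B.tsupport_normed_eq]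
        exact Metric.nonempty_closedBall.2 (by linarith)
      obtain ⟨a, haK, ha⟩ := hK.exists_isLeast hne
      obtain ⟨b, hbK, hb⟩ := hK.exists_isGreatest hne
      have hsub : tsupport ψ ∪ tsupport β ⊆ Ioo 0 L := union_subset hψs hβs
      have hs : ∀ x, x ∉ Icc a b → f x = 0 := by
        intro x hx
        have hx' : x ∉ tsupport ψ ∪ tsupport β := fun h => hx ⟨ha h, hb h⟩
        have h1 : ψ x = 0 := image_eq_zero_of_notMem_tsupport fun h => hx' (Or.inl h)
        have h2 : β x = 0 := image_eq_zero_of_notMem_tsupport fun h => hx' (Or.inr h)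
        simp [f, h1, h2]
      have hψi : Integrable ψ := hψ.continuous.integrable_of_hasCompactSupport hψc
      have hβi : Integrable β := hβ.continuous.integrable_of_hasCompactSupport hβc
      have hfi : ∫ x, f x = 0 := by
        change ∫ x, (ψ x - c * β x) = 0
        rw [integral_sub hψi (hβi.const_mul c), integral_const_mul, hβ1]
        simp [c]
      have h0 : ∫ x in a..b, f x = 0 := by
        rw [intervalIntegral.integral_of_le (hb haK), ← integral_Icc_eq_integral_Ioc,
          setIntegral_eq_integral_of_forall_compl_eq_zero hs, hfi]
      obtain ⟨θ, hθ⟩ := exists_testFunction_deriv_eq hf (hsub haK).1 (hsub hbK).2 hs h0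
      have h1 := hort θ
      rw [hθ] at h1
      have h2 : ∫ x in Ioo 0 L, H10.val u x * f x
          = (∫ x in Ioo 0 L, H10.val u x * ψ x) - c * k := by
        rw [hk, ← integral_const_mul, ← integral_sub (L2.integrable_mul _ hψ.continuous hψc)
          ((L2.integrable_mul _ hβ.continuous hβc).const_mul c)]
        congr 1
        ext x
        simp only [f]
        ring
      rw [← setIntegral_eq_integral_of_forall_compl_eq_zero (s := Ioo 0 L)]
      · have h3 : ∫ x in Ioo 0 L, ψ x = c :=
          setIntegral_eq_integral_of_forall_compl_eq_zero fun x hx =>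
            image_eq_zero_of_notMem_tsupport fun h => hx (hψs h)
        have h4 : ∀ x, ψ x • (H10.val u x - k) = H10.val u x * ψ x - k * ψ x := by
          intro x
          simp only [smul_eq_mul]
          ring
        simp only [h4]
        rw [integral_sub (L2.integrable_mul _ hψ.continuous hψc)
          (hψi.integrableOn.const_mul k), integral_const_mul, h3]
        linarith
      · intro x hx
        rw [image_eq_zero_of_notMem_tsupport fun h => hx (hψs h), zero_smul]
  rw [← ae_restrict_iff' measurableSet_Ioo] at hconst
  have hwk : EqOn w (fun _ => k) (Icc 0 L) := by
    have h1 : w =ᵐ[volume.restrict (Ioo 0 L)] fun _ => k := by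
      filter_upwards [hconst, huw] with x h1 h2
      rw [← h2]
      linarith
    have h2 : EqOn w (fun _ => k) (Ioo 0 L) :=
      Measure.eqOn_open_of_ae_eq h1 isOpen_Ioo (hw.mono Ioo_subset_Icc_self) continuousOn_const
    exact h2.of_subset_closure hw continuousOn_const Ioo_subset_Icc_self
      (by rw [closure_Ioo hL.ne])
  have hk0 : k = 0 := by
    rw [← hw0]
    exact (hwk (left_mem_Icc.2 hL.le)).symm
  filter_upwards [hconst] with x hx
  rw [hk0, sub_zero] at hx
  exact hx

namespace H10

/-- The norm of `H¹₀(0, L)` is `‖u‖ = ‖u'‖_{L²(0, L)}`. -/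
instance (L : ℝ) : NormedAddCommGroup (H10 L) :=
  NormedAddCommGroup.induced (H10 L) (L2 L) der (der_injective L)

instance (L : ℝ) : NormedSpace ℝ (H10 L) := NormedSpace.induced ℝ (H10 L) (L2 L) der

theorem norm_eq {L : ℝ} (u : H10 L) : ‖u‖ = ‖der u‖ := rfl

end H10

/-- Weak convergence of a sequence in a real normed space. -/
def TendstoWeakly {E : Type*} [NormedAddCommGroup E] [NormedSpace ℝ E] (u : ℕ → E) (v : E) :
    Prop :=
  Tendsto (fun n => toWeakSpace ℝ E (u n)) atTop (𝓝 (toWeakSpace ℝ E v))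

/-- `a` is a measurable function on `(0, L)` with `α ≤ a ≤ β` almost everywhere. -/
def IsCoefficient (L α β : ℝ) (a : ℝ → ℝ) : Prop :=
  AEStronglyMeasurable a (intervalMeasure L) ∧ ∀ᵐ x ∂intervalMeasure L, α ≤ a x ∧ a x ≤ β

/-- `φ : ℝ → ℝ ∪ {+∞}` is continuous, and it is finite outside of `0`. -/
structure IsNonlinearity (φ : ℝ → EReal) : Prop where
  continuous : Continuous φ
  ne_bot : ∀ s, φ s ≠ ⊥
  ne_top : ∀ s, s ≠ 0 → φ s ≠ ⊤

/-- The functions `φₙ` form a reasonable sequence of approximations of `φ`. -/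
structure IsReasonableApprox (φ : ℝ → EReal) (φn : ℕ → ℝ → EReal) : Prop where
  isNonlinearity : ∀ n, IsNonlinearity (φn n)
  tendsto : ∀ (s : ℕ → ℝ) (t : ℝ), Tendsto s atTop (𝓝 t) →
    Tendsto (fun n => φn n (s n)) atTop (𝓝 (φ t))

/-- `u` is a weak solution of `-(a u')' = -(φ(u))' - g'` in `(0, L)`, `u(0) = u(L) = 0`:
`u ∈ H¹₀(0, L)`, the function `φ(u)` belongs to `L²(0, L)` (it is almost everywhere equal to some
`w ∈ L²(0, L)`, in particular finite almost everywhere) and the equation holds in the sense of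
distributions on `(0, L)`. -/
def IsWeakSolution (L : ℝ) (a : ℝ → ℝ) (g : L2 L) (φ : ℝ → EReal) (u : H10 L) : Prop :=
  ∃ w : L2 L, (∀ᵐ x ∂intervalMeasure L, φ (H10.val u x) = (w x : EReal)) ∧
    ∀ ψ : 𝓓(openInterval L, ℝ),
      ∫ x in Ioo 0 L, a x * H10.der u x * deriv ψ x =
        (∫ x in Ioo 0 L, w x * deriv ψ x) + ∫ x in Ioo 0 L, g x * deriv ψ x

/-- `u ∈ H¹₀(0, L)` is a classical weak solution of `-(a u')' = -(φ(u))' - g'` in `(0, L)`,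
`u(0) = u(L) = 0`, for a real-valued `φ`: the variational formulation holds for all test functions
`z ∈ H¹₀(0, L)`. -/
def IsClassicalWeakSolution (L : ℝ) (a : ℝ → ℝ) (g : L2 L) (φ : ℝ → ℝ) (u : H10 L) : Prop :=
  ∀ z : H10 L,
    ∫ x in Ioo 0 L, a x * H10.der u x * H10.der z x =
      (∫ x in Ioo 0 L, φ (H10.val u x) * H10.der z x) + ∫ x in Ioo 0 L, g x * H10.der z x

end

/-! In one dimension the derivatives of functions of H¹₀(0, L) are exactly the L² functions of mean
value zero. Hence the variational equation says that the flux a u' - φ(u) - g is a constant c: this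
is `IsClassicalWeakSolution.exists_flux_eq` and its converse `isClassicalWeakSolution_of_flux_eq`.
Moreover φ(u)u' is the derivative of F(u) with F' = φ, so its integral vanishes, and testing with u
gives ‖u'‖ ≤ ‖g‖/α for every continuous φ (`IsClassicalWeakSolution.norm_der_le`).

Existence. For φ bounded and Lipschitz, the initial value problem a u' = c + φ(u) + g, u(0) = 0, is
solved by a contraction, and c is adjusted by the intermediate value theorem so that u(L) = 0. For
continuous φ, the a priori bound confines all solutions to a fixed interval [-R, R]; there φ is
approximated by bounded Lipschitz functions, and Arzelà-Ascoli gives a limit in the integrated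
equation.

Alternative. Weak convergence in H¹₀ gives pointwise convergence of the continuous representatives.
If u ≠ 0, then u is nonzero at some point, and by the uniform Hölder bound the uₙ stay away from 0
on a fixed interval for large n. There φₙ(uₙ) is bounded, so the constants cₙ are bounded
(`exists_abs_flux_le`), so φₙ(uₙ) = aₙuₙ' - cₙ - gₙ is bounded in L² on all of (0, L). By Fatou φ(u)
is finite a.e. and lies in L² (`L2.exists_ae_tendsto`), and every term passes to the limit. The two
cases exclude each other because φ(0) = +∞. -/

/-! ### Primitives and test functions on the interval. -/

theorem setIntegral_Ioo_eq_intervalIntegral {L : ℝ} (hL : 0 ≤ L) (f : ℝ → ℝ) :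
    ∫ x in Ioo 0 L, f x = ∫ x in (0 : ℝ)..L, f x := by
  rw [intervalIntegral.integral_of_le hL, integral_Ioc_eq_integral_Ioo]

theorem intervalIntegrable_of_integrable_Ioo {L x y : ℝ} {f : ℝ → ℝ}
    (hf : Integrable f (intervalMeasure L)) (hx : x ∈ Icc 0 L) (hy : y ∈ Icc 0 L) :
    IntervalIntegrable f volume x y := by
  have h : IntervalIntegrable f volume 0 L := by
    rw [intervalIntegrable_iff_integrableOn_Ioo_of_le (hx.1.trans hx.2)]
    exact hf
  refine h.mono_set ?_
  rw [uIcc_of_le (hx.1.trans hx.2)]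
  exact uIcc_subset_Icc hx hy

theorem continuousOn_primitive_of_integrable_Ioo {L : ℝ} (hL : 0 ≤ L) {f : ℝ → ℝ}
    (hf : Integrable f (intervalMeasure L)) :
    ContinuousOn (fun x => ∫ t in (0 : ℝ)..x, f t) (Icc 0 L) := by
  have h := intervalIntegral.continuousOn_primitive_interval' (μ := volume) (f := f) (a := 0)
    (b₁ := 0) (b₂ := L)
    (intervalIntegrable_of_integrable_Ioo hf (left_mem_Icc.2 hL) (right_mem_Icc.2 hL)) (by simp)
  rwa [uIcc_of_le hL] at h

theorem memLp_of_continuousOn_Icc {L : ℝ} {f : ℝ → ℝ} (hf : ContinuousOn f (Icc 0 L))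
    (p : ℝ≥0∞) : MemLp f p (intervalMeasure L) := by
  obtain ⟨C, hC⟩ := isCompact_Icc.exists_bound_of_continuousOn hf
  refine MemLp.of_bound ((hf.mono Ioo_subset_Icc_self).aestronglyMeasurable measurableSet_Ioo) C ?_
  filter_upwards [ae_restrict_mem measurableSet_Ioo] with x hx
  exact hC x (Ioo_subset_Icc_self hx)

theorem testFunction_eq_zero {L : ℝ} (ψ : 𝓓(openInterval L, ℝ)) {x : ℝ} (hx : x ∉ Ioo 0 L) :
    ψ x = 0 :=
  image_eq_zero_of_notMem_tsupport fun h => hx (ψ.tsupport_subset h)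

theorem testFunction_absolutelyContinuous {L : ℝ} (ψ : 𝓓(openInterval L, ℝ)) (a b : ℝ) :
    AbsolutelyContinuousOnInterval ψ a b :=
  ((ψ.contDiff.of_le (by simp)).contDiffOn).absolutelyContinuousOnInterval

theorem ae_deriv_primitive_eq {L : ℝ} (hL : 0 ≤ L) {f : ℝ → ℝ}
    (hf : Integrable f (intervalMeasure L)) :
    ∀ᵐ x, x ∈ Icc 0 L → HasDerivAt (fun y => ∫ t in (0 : ℝ)..y, f t) (f x) x := by
  have hi := intervalIntegrable_of_integrable_Ioo hf (left_mem_Icc.2 hL) (right_mem_Icc.2 hL)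
  filter_upwards [hi.ae_hasDerivAt_integral] with x hx hxI
  rw [uIcc_of_le hL] at hx
  exact hx hxI 0 (left_mem_Icc.2 hL)

/-- Integration by parts of a primitive against a test function. -/
theorem integral_primitive_mul_deriv {L : ℝ} (hL : 0 ≤ L) {f : ℝ → ℝ}
    (hf : Integrable f (intervalMeasure L)) (ψ : 𝓓(openInterval L, ℝ)) :
    ∫ x in Ioo 0 L, (∫ t in (0 : ℝ)..x, f t) * deriv ψ x = - ∫ x in Ioo 0 L, f x * ψ x := by
  have hi := intervalIntegrable_of_integrable_Ioo hf (left_mem_Icc.2 hL) (right_mem_Icc.2 hL)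
  rw [setIntegral_Ioo_eq_intervalIntegral hL, setIntegral_Ioo_eq_intervalIntegral hL,
    (hi.absolutelyContinuousOnInterval_intervalIntegral
      (by simp)).integral_mul_deriv_eq_deriv_mul (testFunction_absolutelyContinuous ψ 0 L),
    testFunction_eq_zero ψ (by simp), testFunction_eq_zero ψ (by simp)]
  simp only [mul_zero, sub_self, zero_sub, neg_inj]
  refine intervalIntegral.integral_congr_ae ?_
  filter_upwards [ae_deriv_primitive_eq hL hf] with x hx hxI
  rw [uIoc_of_le hL] at hxI
  rw [(hx (Ioc_subset_Icc_self hxI)).deriv]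

/-- Every function of mean value zero is the derivative of a function of `H¹₀(0, L)`. -/
theorem H10.exists_der_eq {L : ℝ} (hL : 0 ≤ L) (v : L2 L) (hv : ∫ x in Ioo 0 L, v x = 0) :
    ∃ z : H10 L, H10.der z = v := by
  have hvi := L2.integrable v
  have hc := continuousOn_primitive_of_integrable_Ioo hL hvi
  let U : L2 L := (memLp_of_continuousOn_Icc hc 2).toLp _
  have hU : U =ᵐ[intervalMeasure L] fun x => ∫ t in (0 : ℝ)..x, v t := MemLp.coeFn_toLp _
  refine ⟨⟨(U, v), fun ψ => ?_, _, hc, by simp, ?_, hU⟩, rfl⟩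
  · rw [← integral_primitive_mul_deriv hL hvi ψ]
    refine integral_congr_ae ?_
    filter_upwards [hU] with x hx
    rw [hx]
  · rw [← setIntegral_Ioo_eq_intervalIntegral hL, hv]

/-! ### Absolutely continuous representatives. -/

/-- An integrable function whose distributional derivative vanishes is constant. -/
theorem exists_ae_eq_const_of_integral_mul_deriv_eq_zero {L : ℝ} (hL : 0 < L) {u : ℝ → ℝ}
    (hu : Integrable u (intervalMeasure L))
    (hort : ∀ θ : 𝓓(openInterval L, ℝ), ∫ x in Ioo 0 L, u x * deriv θ x = 0) :
    ∃ k : ℝ, ∀ᵐ x ∂intervalMeasure L, u x = k := by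
  have hmul {f : ℝ → ℝ} (hf : Continuous f) (hc : HasCompactSupport f) :
      Integrable (fun x => u x * f x) (intervalMeasure L) := by
    obtain ⟨C, hC⟩ := hc.exists_bound_of_continuous hf
    exact hu.mul_bdd (c := C) hf.aestronglyMeasurable (ae_of_all _ hC)
  -- The radii put the support of the bump in [L/4, 3L/4]; the constant sought is the average of `u`
  -- against the normalized bump.
  let B : ContDiffBump (L / 2) := ⟨L / 8, L / 4, by linarith, by linarith⟩
  let β : ℝ → ℝ := B.normed volume
  have hβ : ContDiff ℝ ∞ β := B.contDiff_normed
  have hβc : HasCompactSupport β := B.hasCompactSupport_normed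
  have hβs : tsupport β ⊆ Ioo 0 L := by
    rw [show tsupport β = Metric.closedBall (L / 2) (L / 4) from B.tsupport_normed_eq,
      Real.closedBall_eq_Icc]
    intro x hx
    exact ⟨by linarith [hx.1], by linarith [hx.2]⟩
  have hβ1 : ∫ x, β x = 1 := B.integral_normed
  set k : ℝ := ∫ x in Ioo 0 L, u x * β x with hk
  have hconst : ∀ᵐ x, x ∈ Ioo 0 L → u x - k = 0 := by
    apply isOpen_Ioo.ae_eq_zero_of_integral_contDiff_smul_eq_zero
    · have : IntegrableOn (fun x => u x - k) (Ioo 0 L) volume :=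
        hu.sub (integrable_const k)
      exact this.locallyIntegrableOn
    · intro ψ hψ hψc hψs
      let c : ℝ := ∫ x, ψ x
      -- Subtracting `c * β` makes the integral zero, so `f` is the derivative of a test function.
      -- Then ∫ u f = 0 reads ∫ u ψ = c k, that is, ∫ (u - k) ψ = 0.
      let f : ℝ → ℝ := fun x => ψ x - c * β x
      have hf : ContDiff ℝ ∞ f := hψ.sub (contDiff_const.mul hβ)
      have hK : IsCompact (tsupport ψ ∪ tsupport β) :=
        IsCompact.union hψc hβc
      have hne : (tsupport ψ ∪ tsupport β).Nonempty := by
        refine Nonempty.inr ?_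
        rw [show tsupport β = Metric.closedBall (L / 2) (L / 4) from B.tsupport_normed_eq]
        exact Metric.nonempty_closedBall.2 (by linarith)
      obtain ⟨a, haK, ha⟩ := hK.exists_isLeast hne
      obtain ⟨b, hbK, hb⟩ := hK.exists_isGreatest hne
      have hsub : tsupport ψ ∪ tsupport β ⊆ Ioo 0 L := union_subset hψs hβs
      have hs : ∀ x, x ∉ Icc a b → f x = 0 := by
        intro x hx
        have hx' : x ∉ tsupport ψ ∪ tsupport β := fun h => hx ⟨ha h, hb h⟩
        have h1 : ψ x = 0 := image_eq_zero_of_notMem_tsupport fun h => hx' (Or.inl h)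
        have h2 : β x = 0 := image_eq_zero_of_notMem_tsupport fun h => hx' (Or.inr h)
        simp [f, h1, h2]
      have hψi : Integrable ψ := hψ.continuous.integrable_of_hasCompactSupport hψc
      have hβi : Integrable β := hβ.continuous.integrable_of_hasCompactSupport hβc
      have hfi : ∫ x, f x = 0 := by
        change ∫ x, (ψ x - c * β x) = 0
        rw [integral_sub hψi (hβi.const_mul c), integral_const_mul, hβ1]
        simp [c]
      have h0 : ∫ x in a..b, f x = 0 := by
        rw [intervalIntegral.integral_of_le (hb haK), ← integral_Icc_eq_integral_Ioc,
          setIntegral_eq_integral_of_forall_compl_eq_zero hs, hfi]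
      obtain ⟨θ, hθ⟩ := exists_testFunction_deriv_eq hf (hsub haK).1 (hsub hbK).2 hs h0
      have h1 := hort θ
      rw [hθ] at h1
      have h2 : ∫ x in Ioo 0 L, u x * f x = (∫ x in Ioo 0 L, u x * ψ x) - c * k := by
        rw [hk, ← integral_const_mul, ← integral_sub (hmul hψ.continuous hψc)
          ((hmul hβ.continuous hβc).const_mul c)]
        congr 1
        ext x
        simp only [f]
        ring
      rw [← setIntegral_eq_integral_of_forall_compl_eq_zero (s := Ioo 0 L)]
      · have h3 : ∫ x in Ioo 0 L, ψ x = c :=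
          setIntegral_eq_integral_of_forall_compl_eq_zero fun x hx =>
            image_eq_zero_of_notMem_tsupport fun h => hx (hψs h)
        have h4 : ∀ x, ψ x • (u x - k) = u x * ψ x - k * ψ x := by
          intro x
          simp only [smul_eq_mul]
          ring
        simp only [h4]
        rw [integral_sub (hmul hψ.continuous hψc)
          (hψi.integrableOn.const_mul k), integral_const_mul, h3]
        linarith
      · intro x hx
        rw [image_eq_zero_of_notMem_tsupport fun h => hx (hψs h), zero_smul]
  refine ⟨k, ?_⟩
  rw [← ae_restrict_iff' measurableSet_Ioo] at hconst
  filter_upwards [hconst] with x hx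
  linarith

namespace H10

/-- The absolutely continuous representative of a function of `H¹₀(0, L)`. -/
noncomputable def rep {L : ℝ} (u : H10 L) (x : ℝ) : ℝ := ∫ t in (0 : ℝ)..x, der u t

theorem continuousOn_rep {L : ℝ} (hL : 0 ≤ L) (u : H10 L) : ContinuousOn (rep u) (Icc 0 L) :=
  continuousOn_primitive_of_integrable_Ioo hL (L2.integrable _)

theorem absolutelyContinuous_rep {L : ℝ} (hL : 0 ≤ L) (u : H10 L) :
    AbsolutelyContinuousOnInterval (rep u) 0 L :=
  (intervalIntegrable_of_integrable_Ioo (L2.integrable (der u)) (left_mem_Icc.2 hL)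
    (right_mem_Icc.2 hL)).absolutelyContinuousOnInterval_intervalIntegral (by simp)

theorem ae_hasDerivAt_rep {L : ℝ} (hL : 0 ≤ L) (u : H10 L) :
    ∀ᵐ x, x ∈ Icc 0 L → HasDerivAt (rep u) (der u x) x :=
  ae_deriv_primitive_eq hL (L2.integrable _)

theorem rep_zero {L : ℝ} (u : H10 L) : rep u 0 = 0 := intervalIntegral.integral_same

/-- The difference `val u - rep u` has zero distributional derivative, hence is a constant. The
continuous representative `w` given by `VanishesAtEnds` then equals `rep u` plus this constant up to
the ends: its value at 0 makes the constant zero, its value at `L` gives the second claim. -/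
theorem val_ae_eq_rep_and_rep_right {L : ℝ} (hL : 0 < L) (u : H10 L) :
    val u =ᵐ[intervalMeasure L] rep u ∧ rep u L = 0 := by
  have hc := continuousOn_rep hL.le u
  have hri : Integrable (rep u) (intervalMeasure L) :=
    (memLp_of_continuousOn_Icc hc 1).integrable le_rfl
  obtain ⟨k, hk⟩ := exists_ae_eq_const_of_integral_mul_deriv_eq_zero hL
    (u := fun x => val u x - rep u x) ((L2.integrable _).sub hri) (by
      intro θ
      obtain ⟨C, hC⟩ := θ.hasCompactSupport.deriv.exists_bound_of_continuous
        (testFunction_continuous_deriv θ)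
      simp only [sub_mul]
      rw [integral_sub (L2.integrable_mul _ (testFunction_continuous_deriv θ)
        θ.hasCompactSupport.deriv) (hri.mul_bdd (c := C)
          (testFunction_continuous_deriv θ).aestronglyMeasurable (ae_of_all _ hC)),
        u.isWeakDeriv θ, sub_eq_zero]
      exact (integral_primitive_mul_deriv hL.le (L2.integrable _) θ).symm)
  obtain ⟨w, hw, hw0, hwL, huw⟩ := u.vanishesAtEnds
  have hwk : EqOn w (fun x => rep u x + k) (Icc 0 L) := by
    have h1 : w =ᵐ[volume.restrict (Ioo 0 L)] fun x => rep u x + k := by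
      filter_upwards [hk, huw] with x h1 h2
      rw [← h2]
      linarith
    have h2 : EqOn w (fun x => rep u x + k) (Ioo 0 L) :=
      Measure.eqOn_open_of_ae_eq h1 isOpen_Ioo (hw.mono Ioo_subset_Icc_self)
        ((hc.add continuousOn_const).mono Ioo_subset_Icc_self)
    exact h2.of_subset_closure hw (hc.add continuousOn_const) Ioo_subset_Icc_self
      (by rw [closure_Ioo hL.ne])
  have hk0 : k = 0 := by
    have := hwk (left_mem_Icc.2 hL.le)
    simpa [hw0, rep_zero] using this.symm
  have hkL := hwk (right_mem_Icc.2 hL.le)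
  simp only [hwL, hk0, add_zero] at hkL
  refine ⟨?_, hkL.symm⟩
  filter_upwards [hk] with x hx
  rw [hk0] at hx
  linarith

theorem val_ae_eq_rep {L : ℝ} (hL : 0 < L) (u : H10 L) : val u =ᵐ[intervalMeasure L] rep u :=
  (val_ae_eq_rep_and_rep_right hL u).1

theorem rep_right {L : ℝ} (hL : 0 < L) (u : H10 L) : rep u L = 0 :=
  (val_ae_eq_rep_and_rep_right hL u).2

theorem integral_der {L : ℝ} (hL : 0 < L) (u : H10 L) : ∫ x in Ioo 0 L, der u x = 0 := by
  rw [setIntegral_Ioo_eq_intervalIntegral hL.le]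
  exact rep_right hL u

theorem integral_deriv_testFunction {L : ℝ} (hL : 0 ≤ L) (ψ : 𝓓(openInterval L, ℝ)) :
    ∫ x in Ioo 0 L, deriv ψ x = 0 := by
  rw [setIntegral_Ioo_eq_intervalIntegral hL,
    (testFunction_absolutelyContinuous ψ 0 L).integral_deriv_eq_sub,
    testFunction_eq_zero ψ (by simp), testFunction_eq_zero ψ (by simp), sub_self]

end H10

/-! ### Energy identity, constancy of the flux and a priori bound. -/

/-- This makes the fundamental theorem of calculus available for F(u) with F of class C¹, which is
Lipschitz on the bounded range of u. -/
theorem AbsolutelyContinuousOnInterval.lipschitzOnWith_comp {f F : ℝ → ℝ} {a b : ℝ} {s : Set ℝ}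
    {K : NNReal} (hF : LipschitzOnWith K F s) (hf : AbsolutelyContinuousOnInterval f a b)
    (hs : MapsTo f (uIcc a b) s) : AbsolutelyContinuousOnInterval (F ∘ f) a b := by
  have h := Tendsto.const_mul (K : ℝ) hf
  rw [mul_zero] at h
  refine squeeze_zero' (Eventually.of_forall fun E => Finset.sum_nonneg fun _ _ => dist_nonneg)
    ?_ h
  filter_upwards [mem_inf_of_right (mem_principal_self _)] with E hE
  rw [Finset.mul_sum]
  refine Finset.sum_le_sum fun i hi => ?_
  exact hF.dist_le_mul _ (hs (hE.1 i hi).1) _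
    (hs (hE.1 i hi).2)

/-- The nonlinear term `φ(u)'` does not contribute to the energy. -/
theorem H10.integral_comp_mul_der {L : ℝ} (hL : 0 < L) (u : H10 L) {φ : ℝ → ℝ}
    (hφ : Continuous φ) : ∫ x in Ioo 0 L, φ (val u x) * der u x = 0 := by
  let F : ℝ → ℝ := fun s => ∫ t in (0 : ℝ)..s, φ t
  have hF : ∀ s, HasDerivAt F (φ s) s := fun s => hφ.integral_hasStrictDerivAt 0 s |>.hasDerivAt
  have hF1 : ContDiff ℝ 1 F := by
    rw [contDiff_one_iff_deriv]
    exact ⟨fun s => (hF s).differentiableAt, by rwa [funext fun s => (hF s).deriv]⟩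
  obtain ⟨R, hR⟩ := isCompact_Icc.exists_bound_of_continuousOn (continuousOn_rep hL.le u)
  obtain ⟨K, hK⟩ := (hF1.contDiffOn (s := Icc (-R) R)).exists_lipschitzOnWith one_ne_zero
    (convex_Icc _ _) isCompact_Icc
  have hac : AbsolutelyContinuousOnInterval (F ∘ rep u) 0 L :=
    (absolutelyContinuous_rep hL.le u).lipschitzOnWith_comp hK fun x hx => by
      rw [uIcc_of_le hL.le] at hx
      exact abs_le.1 (hR x hx)
  have h : ∫ x in (0 : ℝ)..L, deriv (F ∘ rep u) x = _ := hac.integral_deriv_eq_sub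
  rw [Function.comp_apply, Function.comp_apply, rep_right hL, rep_zero, sub_self,
    ← setIntegral_Ioo_eq_intervalIntegral hL.le] at h
  refine (integral_congr_ae ?_).trans h
  filter_upwards [val_ae_eq_rep hL u, ae_restrict_of_ae (ae_hasDerivAt_rep hL.le u),
    ae_restrict_mem measurableSet_Ioo] with x h1 h2 h3
  have h4 : HasDerivAt (F ∘ rep u) (φ (rep u x) * der u x) x :=
    (hF _).comp x (h2 (Ioo_subset_Icc_self h3))
  rw [h1, h4.deriv]

theorem L2.integral_mul_eq_inner {L : ℝ} (u v : L2 L) :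
    ∫ x in Ioo 0 L, u x * v x = inner ℝ u v := by
  rw [MeasureTheory.L2.inner_def]
  refine integral_congr_ae (ae_of_all _ fun x => ?_)
  simp [mul_comm]

theorem MeasureTheory.MemLp.coefficient_mul {L α β : ℝ} {a : ℝ → ℝ} (ha : IsCoefficient L α β a)
    {f : ℝ → ℝ} (hf : MemLp f 2 (intervalMeasure L)) :
    MemLp (fun x => a x * f x) 2 (intervalMeasure L) := by
  refine hf.of_le_mul (c := max |α| |β|) (ha.1.mul hf.1) ?_
  filter_upwards [ha.2] with x hx
  rw [norm_mul]
  exact mul_le_mul_of_nonneg_right (abs_le_max_abs_abs hx.1 hx.2) (norm_nonneg _)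

theorem H10.memLp_comp_val {L : ℝ} (hL : 0 < L) (u : H10 L) {φ : ℝ → ℝ} (hφ : Continuous φ)
    (p : ℝ≥0∞) : MemLp (fun x => φ (val u x)) p (intervalMeasure L) := by
  refine (memLp_of_continuousOn_Icc (hφ.comp_continuousOn (continuousOn_rep hL.le u)) p).ae_eq ?_
  filter_upwards [val_ae_eq_rep hL u] with x hx
  rw [hx, Function.comp_apply]

/-- The flux `a u' - φ(u) - g` of a classical weak solution is constant. -/
theorem IsClassicalWeakSolution.exists_flux_eq {L α β : ℝ} (hL : 0 < L) {a : ℝ → ℝ}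
    (ha : IsCoefficient L α β a) {g : L2 L} {φ : ℝ → ℝ} (hφ : Continuous φ) {u : H10 L}
    (hu : IsClassicalWeakSolution L a g φ u) :
    ∃ c : ℝ, ∀ᵐ x ∂intervalMeasure L, a x * H10.der u x = c + φ (H10.val u x) + g x := by
  have h1 : MemLp (fun x => a x * H10.der u x) 2 (intervalMeasure L) :=
    (Lp.memLp (H10.der u)).coefficient_mul ha
  have h2 : MemLp (fun x => φ (H10.val u x)) 2 (intervalMeasure L) := H10.memLp_comp_val hL u hφ 2
  have h3 : MemLp (fun x => g x) 2 (intervalMeasure L) := Lp.memLp g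
  let F : ℝ → ℝ := fun x => a x * H10.der u x - φ (H10.val u x) - g x
  have hF : MemLp F 2 (intervalMeasure L) := (h1.sub h2).sub h3
  -- With `m` the mean of the flux `F`, the function `V = F - m` is an admissible z'. The equation
  -- gives ∫ F V = 0, hence ∫ V² = ∫ F V - m ∫ V = 0.
  set m : ℝ := (∫ x in Ioo 0 L, F x) / L with hm
  have hG : MemLp (fun x => F x - m) 2 (intervalMeasure L) := hF.sub (memLp_const m)
  let V : L2 L := hG.toLp _
  have hV : V =ᵐ[intervalMeasure L] fun x => F x - m := MemLp.coeFn_toLp _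
  have hV0 : ∫ x in Ioo 0 L, V x = 0 := by
    rw [integral_congr_ae hV, integral_sub (hF.integrable one_le_two) (integrable_const m)]
    simp only [integral_const, measureReal_restrict_apply_univ, Real.volume_real_Ioo_of_le hL.le,
      hm, smul_eq_mul]
    field_simp
    ring
  obtain ⟨z, hz⟩ := H10.exists_der_eq hL.le V hV0
  have key := hu z
  rw [hz] at key
  have hV2 : MemLp (fun x => V x) 2 (intervalMeasure L) := Lp.memLp V
  have i1 : Integrable (fun x => a x * H10.der u x * V x) (intervalMeasure L) :=
    h1.integrable_mul hV2
  have i2 : Integrable (fun x => φ (H10.val u x) * V x) (intervalMeasure L) :=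
    h2.integrable_mul hV2
  have i3 : Integrable (fun x => g x * V x) (intervalMeasure L) := h3.integrable_mul hV2
  have hsq : ∫ x in Ioo 0 L, V x * V x = 0 := by
    have : ∫ x in Ioo 0 L, V x * V x = ∫ x in Ioo 0 L,
        (a x * H10.der u x * V x - φ (H10.val u x) * V x - g x * V x - m * V x) := by
      refine integral_congr_ae ?_
      filter_upwards [hV] with x hx
      rw [hx]
      simp only [F]
      ring
    have i4 : Integrable (fun x => a x * H10.der u x * V x - φ (H10.val u x) * V x)
        (intervalMeasure L) := i1.sub i2
    have i5 : Integrable (fun x => a x * H10.der u x * V x - φ (H10.val u x) * V x - g x * V x)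
        (intervalMeasure L) := i4.sub i3
    rw [this, integral_sub i5 ((hV2.integrable one_le_two).const_mul m),
      integral_sub i4 i3, integral_sub i1 i2, integral_const_mul, hV0, key]
    ring
  rw [L2.integral_mul_eq_inner, inner_self_eq_zero, Lp.eq_zero_iff_ae_eq_zero] at hsq
  refine ⟨m, ?_⟩
  filter_upwards [hsq, hV] with x hx1 hx2
  rw [hx1] at hx2
  simp only [F, Pi.zero_apply] at hx2
  linarith

/-- A constant flux is orthogonal to every z', which has mean value zero. -/
theorem isClassicalWeakSolution_of_flux_eq {L : ℝ} (hL : 0 < L) {a : ℝ → ℝ} {g : L2 L}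
    {φ : ℝ → ℝ} (hφ : Continuous φ) {u : H10 L} {c : ℝ}
    (h : ∀ᵐ x ∂intervalMeasure L, a x * H10.der u x = c + φ (H10.val u x) + g x) :
    IsClassicalWeakSolution L a g φ u := by
  intro z
  have hz : MemLp (fun x => H10.der z x) 2 (intervalMeasure L) := Lp.memLp _
  have h2 : MemLp (fun x => φ (H10.val u x)) 2 (intervalMeasure L) := H10.memLp_comp_val hL u hφ 2
  have h3 : MemLp (fun x => g x) 2 (intervalMeasure L) := Lp.memLp g
  have i2 : Integrable (fun x => φ (H10.val u x) * H10.der z x) (intervalMeasure L) :=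
    h2.integrable_mul hz
  have i3 : Integrable (fun x => g x * H10.der z x) (intervalMeasure L) := h3.integrable_mul hz
  have : ∫ x in Ioo 0 L, a x * H10.der u x * H10.der z x = ∫ x in Ioo 0 L,
      (c * H10.der z x + φ (H10.val u x) * H10.der z x + g x * H10.der z x) := by
    refine integral_congr_ae ?_
    filter_upwards [h] with x hx
    rw [hx]
    ring
  have i1 : Integrable (fun x => c * H10.der z x) (intervalMeasure L) :=
    (hz.integrable one_le_two).const_mul c
  rw [this, integral_add (i1.fun_add i2) i3, integral_add i1 i2, integral_const_mul,
    H10.integral_der hL]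
  ring

/-- The a priori estimate, by testing the equation with the solution. -/
theorem IsClassicalWeakSolution.norm_der_le {L α β : ℝ} (hL : 0 < L) (hα : 0 < α) {a : ℝ → ℝ}
    (ha : IsCoefficient L α β a) {g : L2 L} {φ : ℝ → ℝ} (hφ : Continuous φ) {u : H10 L}
    (hu : IsClassicalWeakSolution L a g φ u) : ‖H10.der u‖ ≤ ‖g‖ / α := by
  have h1 : MemLp (fun x => a x * H10.der u x) 2 (intervalMeasure L) :=
    (Lp.memLp (H10.der u)).coefficient_mul ha
  have h0 : MemLp (fun x => H10.der u x) 2 (intervalMeasure L) := Lp.memLp (H10.der u)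
  have i0 : Integrable (fun x => H10.der u x * H10.der u x) (intervalMeasure L) :=
    h0.integrable_mul h0
  have i1 : Integrable (fun x => a x * H10.der u x * H10.der u x) (intervalMeasure L) :=
    h1.integrable_mul h0
  have hle : α * (‖H10.der u‖ * ‖H10.der u‖) ≤ ‖g‖ * ‖H10.der u‖ := by
    calc α * (‖H10.der u‖ * ‖H10.der u‖)
        = ∫ x in Ioo 0 L, α * (H10.der u x * H10.der u x) := by
          rw [integral_const_mul, L2.integral_mul_eq_inner, real_inner_self_eq_norm_mul_norm]
      _ ≤ ∫ x in Ioo 0 L, a x * H10.der u x * H10.der u x := by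
          refine integral_mono_ae (i0.const_mul α) i1 ?_
          filter_upwards [ha.2] with x hx
          rw [mul_assoc]
          exact mul_le_mul_of_nonneg_right hx.1 (mul_self_nonneg _)
      _ = inner ℝ g (H10.der u) := by
          rw [hu u, H10.integral_comp_mul_der hL u hφ, zero_add, L2.integral_mul_eq_inner]
      _ ≤ ‖g‖ * ‖H10.der u‖ := real_inner_le_norm _ _
  rw [le_div_iff₀ hα]
  rcases (norm_nonneg (H10.der u)).eq_or_lt with h | h
  · rw [← h, zero_mul]
    exact norm_nonneg g
  · nlinarith

/-! ### Hölder estimate and the shooting method. -/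

/-- Functions of `H¹₀(0, L)` are Hölder continuous of exponent `1 / 2`. -/
theorem H10.abs_rep_sub_rep_le {L : ℝ} (u : H10 L) {x y : ℝ} (hx : x ∈ Icc 0 L)
    (hy : y ∈ Icc 0 L) : |rep u x - rep u y| ≤ √|x - y| * ‖u‖ := by
  wlog hxy : y ≤ x generalizing x y
  · rw [abs_sub_comm, abs_sub_comm x]
    exact this hy hx (le_of_not_ge hxy)
  have hL : 0 ≤ L := hx.1.trans hx.2
  have h0 := left_mem_Icc.2 hL
  have hi := L2.integrable (der u)
  have hd : MemLp (fun x => der u x) 2 (intervalMeasure L) := Lp.memLp _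
  -- The increment is the inner product of u' with an indicator of norm √|x - y|; Cauchy-Schwarz
  -- concludes.
  have e1 : rep u x - rep u y = ∫ t in Ioo 0 L, (Ioo y x).indicator 1 t * der u t := by
    rw [rep, rep, intervalIntegral.integral_interval_sub_left
      (intervalIntegrable_of_integrable_Ioo hi h0 hx)
      (intervalIntegrable_of_integrable_Ioo hi h0 hy), intervalIntegral.integral_of_le hxy,
      integral_Ioc_eq_integral_Ioo]
    have : ∀ t, (Ioo y x).indicator 1 t * der u t = (Ioo y x).indicator (der u) t := by
      intro t
      by_cases ht : t ∈ Ioo y x <;> simp [ht]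
    simp only [this]
    rw [setIntegral_indicator measurableSet_Ioo, inter_eq_right.2 (Ioo_subset_Ioo hy.1 hx.2)]
  have hχ : MemLp ((Ioo y x).indicator (1 : ℝ → ℝ)) 2 (intervalMeasure L) :=
    (memLp_const (1 : ℝ)).indicator measurableSet_Ioo
  let X : L2 L := hχ.toLp _
  have hX : X =ᵐ[intervalMeasure L] (Ioo y x).indicator 1 := MemLp.coeFn_toLp _
  have e2 : rep u x - rep u y = inner ℝ X (der u) := by
    rw [e1, ← L2.integral_mul_eq_inner]
    refine integral_congr_ae ?_
    filter_upwards [hX] with t ht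
    rw [ht]
  have hn : ‖X‖ = √|x - y| := by
    rw [norm_eq_sqrt_real_inner, ← L2.integral_mul_eq_inner]
    congr 1
    have : ∫ t in Ioo 0 L, X t * X t = ∫ t in Ioo 0 L, (Ioo y x).indicator (fun _ => (1 : ℝ)) t := by
      refine integral_congr_ae ?_
      filter_upwards [hX] with t ht
      rw [ht]
      by_cases ht : t ∈ Ioo y x <;> simp [ht]
    rw [this, setIntegral_indicator measurableSet_Ioo, inter_eq_right.2 (Ioo_subset_Ioo hy.1 hx.2)]
    simp [hxy, abs_of_nonneg (sub_nonneg.2 hxy)]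
  rw [e2, ← hn]
  exact abs_real_inner_le_norm _ _

theorem integrable_mul_inv_coefficient {L α β : ℝ} (hα : 0 < α) {a : ℝ → ℝ}
    (ha : IsCoefficient L α β a) {f : ℝ → ℝ} (hf : Integrable f (intervalMeasure L)) :
    Integrable (fun x => f x * (a x)⁻¹) (intervalMeasure L) := by
  refine hf.mul_bdd (c := α⁻¹) ha.1.inv₀ ?_
  filter_upwards [ha.2] with x hx
  rw [Real.norm_eq_abs, abs_of_nonneg (inv_nonneg.2 (hα.le.trans hx.1))]
  exact inv_anti₀ hα hx.1

/-- A solution of the integrated equation which vanishes at the right end yields a classical weak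
solution. -/
theorem exists_isClassicalWeakSolution_of_integral_eq {L α β : ℝ} (hL : 0 < L) (hα : 0 < α)
    {a : ℝ → ℝ} (ha : IsCoefficient L α β a) {g : L2 L} {φ : ℝ → ℝ} (hφ : Continuous φ)
    {u : ℝ → ℝ} (hu : ContinuousOn u (Icc 0 L)) {c : ℝ}
    (h : ∀ x ∈ Icc 0 L, u x = ∫ t in (0 : ℝ)..x, (c + φ (u t) + g t) * (a t)⁻¹) (huL : u L = 0) :
    ∃ z : H10 L, IsClassicalWeakSolution L a g φ z := by
  have hf : MemLp (fun t => c + φ (u t) + g t) 2 (intervalMeasure L) :=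
    ((memLp_const c).add (memLp_of_continuousOn_Icc (hφ.comp_continuousOn hu) 2)).add (Lp.memLp g)
  have hm : MemLp (fun t => (c + φ (u t) + g t) * (a t)⁻¹) 2 (intervalMeasure L) := by
    refine hf.of_le_mul (c := α⁻¹) (hf.1.mul ha.1.inv₀) ?_
    filter_upwards [ha.2] with x hx
    rw [norm_mul, mul_comm, Real.norm_eq_abs (a x)⁻¹,
      abs_of_nonneg (inv_nonneg.2 (hα.le.trans hx.1))]
    exact mul_le_mul_of_nonneg_right (inv_anti₀ hα hx.1) (norm_nonneg _)
  let v : L2 L := hm.toLp _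
  have hv : v =ᵐ[intervalMeasure L] fun t => (c + φ (u t) + g t) * (a t)⁻¹ := MemLp.coeFn_toLp _
  obtain ⟨z, hz⟩ := H10.exists_der_eq hL.le v (by
    rw [integral_congr_ae hv, setIntegral_Ioo_eq_intervalIntegral hL.le,
      ← h L (right_mem_Icc.2 hL.le), huL])
  have hrep : ∀ x ∈ Ioo 0 L, H10.rep z x = u x := by
    intro x hx
    rw [h x (Ioo_subset_Icc_self hx), H10.rep, hz, intervalIntegral.integral_of_le hx.1.le,
      intervalIntegral.integral_of_le hx.1.le, integral_Ioc_eq_integral_Ioo,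
      integral_Ioc_eq_integral_Ioo]
    exact integral_congr_ae (ae_restrict_of_ae_restrict_of_subset (Ioo_subset_Ioo_right hx.2.le) hv)
  refine ⟨z, isClassicalWeakSolution_of_flux_eq hL hφ (c := c) ?_⟩
  filter_upwards [hv, H10.val_ae_eq_rep hL z, ae_restrict_mem measurableSet_Ioo, ha.2]
    with x h1 h2 h3 h4
  rw [hz, h1, h2, hrep x h3]
  have : a x ≠ 0 := (hα.trans_le h4.1).ne'
  field_simp

/-- The initial value problem `a u' = c + φ(u) + g`, `u(0) = 0`, with `φ` Lipschitz continuous: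
there are solutions whose end values depend continuously on `c`. -/
theorem exists_initialValueProblem_solution {L α β : ℝ} (hL : 0 < L) (hα : 0 < α)
    {a : ℝ → ℝ} (ha : IsCoefficient L α β a) {g : L2 L} {φ : ℝ → ℝ} {K : NNReal}
    (hφ : LipschitzWith K φ) :
    ∃ u : ℝ → ℝ → ℝ, (∀ c, ContinuousOn (u c) (Icc 0 L)) ∧
      (∀ c, ∀ x ∈ Icc 0 L, u c x = ∫ t in (0 : ℝ)..x, (c + φ (u c t) + g t) * (a t)⁻¹) ∧
      Continuous fun c => u c L := by
  have h0L := left_mem_Icc.2 hL.le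
  -- The contraction acts on w = e^{-lt}u, for which its constant is at most K/(αl) ≤ 1/2. The
  -- summand 1 keeps `l` positive when `K = 0`.
  set l : ℝ := 2 * K / α + 1 with hl
  have hlpos : 0 < l := by positivity
  let E := C(Icc (0 : ℝ) L, ℝ)
  let lift : E → ℝ → ℝ := fun w t => Real.exp (l * t) * w (projIcc 0 L hL.le t)
  have hlift : ∀ w, Continuous (lift w) := fun w => by
    have := w.continuous
    have := continuous_projIcc (a := (0 : ℝ)) (b := L) (h := hL.le)
    fun_prop
  let H : ℝ → E → ℝ → ℝ := fun c w t => (c + φ (lift w t) + g t) * (a t)⁻¹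
  have hH : ∀ c w, Integrable (H c w) (intervalMeasure L) := by
    intro c w
    refine integrable_mul_inv_coefficient hα ha (Integrable.add (Integrable.add
      (integrable_const c) ?_) (L2.integrable g))
    exact (memLp_of_continuousOn_Icc
      (hφ.continuous.comp (hlift w)).continuousOn 1).integrable le_rfl
  let S : ℝ → E → E := fun c w => ⟨fun x => Real.exp (-(l * x)) * ∫ t in (0 : ℝ)..x, H c w t,
    (Real.continuous_exp.comp (continuous_const.mul continuous_subtype_val).neg).mul
      (continuousOn_iff_continuous_domRestrict.1
        (continuousOn_primitive_of_integrable_Ioo hL.le (hH c w)))⟩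
  -- One estimate for two uses: `B` is exponential for the contraction in `w`, and constant for the
  -- dependence on `c`.
  have hdiff : ∀ c c' w w' (x : Icc (0 : ℝ) L) (B : ℝ → ℝ), Continuous B →
      (∀ t ∈ Icc 0 L, |c + φ (lift w t) - (c' + φ (lift w' t))| * α⁻¹ ≤ B t) →
      |S c w x - S c' w' x| ≤ Real.exp (-(l * x)) * ∫ t in (0 : ℝ)..x, B t := by
    intro c c' w w' x B hB hle
    have e : S c w x - S c' w' x
        = Real.exp (-(l * x)) * ∫ t in (0 : ℝ)..x, (H c w t - H c' w' t) := by
      rw [intervalIntegral.integral_sub (intervalIntegrable_of_integrable_Ioo (hH c w) h0L x.2)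
        (intervalIntegrable_of_integrable_Ioo (hH c' w') h0L x.2), mul_sub]
      rfl
    rw [e, abs_mul, abs_of_pos (Real.exp_pos _)]
    refine mul_le_mul_of_nonneg_left ?_ (Real.exp_pos _).le
    rw [← Real.norm_eq_abs]
    refine intervalIntegral.norm_integral_le_of_norm_le x.2.1 ?_
      (hB.intervalIntegrable (μ := volume) _ _)
    have hae := (ae_restrict_iff' measurableSet_Ioo).1 ha.2
    have hne : ∀ᵐ t : ℝ, t ≠ L := by simp [ae_iff]
    filter_upwards [hae, hne] with t ht htL htx
    have htI : t ∈ Ioo 0 L := ⟨htx.1, lt_of_le_of_ne (htx.2.trans x.2.2) htL⟩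
    have hat := ht htI
    refine le_trans ?_ (hle t (Ioo_subset_Icc_self htI))
    have : H c w t - H c' w' t = (c + φ (lift w t) - (c' + φ (lift w' t))) * (a t)⁻¹ := by
      simp only [H]
      ring
    rw [this, norm_mul, Real.norm_eq_abs, Real.norm_eq_abs,
      abs_of_nonneg (inv_nonneg.2 (hα.le.trans hat.1))]
    exact mul_le_mul_of_nonneg_left (inv_anti₀ hα hat.1) (abs_nonneg _)
  have hcontr : ∀ c, ContractingWith (1 / 2) (S c) := by
    intro c
    refine ⟨by norm_num, LipschitzWith.of_dist_le_mul fun w w' => ?_⟩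
    rw [ContinuousMap.dist_le (by positivity)]
    intro x
    rw [Real.dist_eq]
    refine (hdiff c c w w' x (fun t => K * α⁻¹ * dist w w' * Real.exp (l * t)) (by fun_prop)
      fun t ht => ?_).trans ?_
    · rw [add_sub_add_left_eq_sub, ← Real.dist_eq]
      have h1 := hφ.dist_le_mul (lift w t) (lift w' t)
      have h2 : dist (lift w t) (lift w' t) ≤ Real.exp (l * t) * dist w w' := by
        simp only [lift]
        rw [Real.dist_eq, ← mul_sub, abs_mul, abs_of_pos (Real.exp_pos _), ← Real.dist_eq]
        exact mul_le_mul_of_nonneg_left (ContinuousMap.dist_apply_le_dist _) (Real.exp_pos _).le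
      calc dist (φ (lift w t)) (φ (lift w' t)) * α⁻¹
          ≤ K * (Real.exp (l * t) * dist w w') * α⁻¹ := by gcongr; exact h1.trans (by gcongr)
        _ = K * α⁻¹ * dist w w' * Real.exp (l * t) := by ring
    · have hint : ∫ t in (0 : ℝ)..x, Real.exp (l * t) = (Real.exp (l * x) - 1) / l := by
        rw [intervalIntegral.integral_comp_mul_left (fun t => Real.exp t) hlpos.ne']
        simp [integral_exp]
        field_simp
      rw [intervalIntegral.integral_const_mul, hint]
      have hexp : Real.exp (-(l * x)) * (Real.exp (l * x) - 1) ≤ 1 := by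
        rw [mul_sub, ← Real.exp_add]
        simp [(Real.exp_pos _).le]
      have hK : (K : ℝ) * α⁻¹ / l ≤ 1 / 2 := by
        rw [div_le_iff₀ hlpos, hl]
        ring_nf
        linarith
      calc Real.exp (-(l * x)) * (K * α⁻¹ * dist w w' * ((Real.exp (l * x) - 1) / l))
          = (K * α⁻¹ / l) * dist w w' * (Real.exp (-(l * x)) * (Real.exp (l * x) - 1)) := by ring
        _ ≤ (1 / 2) * dist w w' * 1 := by
          refine mul_le_mul (mul_le_mul_of_nonneg_right hK dist_nonneg) hexp ?_ (by positivity)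
          refine mul_nonneg (Real.exp_pos _).le (sub_nonneg.2 (Real.one_le_exp ?_))
          exact mul_nonneg hlpos.le x.2.1
        _ = _ := by push_cast; ring
  let W : ℝ → E := fun c => (hcontr c).fixedPoint
  have hW : ∀ c, S c (W c) = W c := fun c => (hcontr c).fixedPoint_isFixedPt
  -- Changing `c` moves the map by at most (L/α)|c - c'|; the factor 2 is 1/(1 - 1/2).
  have hWc : Continuous W := by
    have : LipschitzWith (2 * Real.toNNReal (L * α⁻¹)) W := by
      refine LipschitzWith.of_dist_le_mul fun c c' => ?_
      refine ((hcontr c).fixedPoint_lipschitz_in_map (hcontr c')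
        (C := L * α⁻¹ * dist c c') fun w => ?_).trans (le_of_eq ?_)
      · rw [ContinuousMap.dist_le (by positivity)]
        intro x
        rw [Real.dist_eq]
        refine (hdiff c c' w w x (fun t => dist c c' * α⁻¹) (by fun_prop) fun t ht => ?_).trans ?_
        · rw [add_sub_add_right_eq_sub, ← Real.dist_eq]
        · rw [intervalIntegral.integral_const, smul_eq_mul, sub_zero]
          have h1 : Real.exp (-(l * x)) ≤ 1 :=
            Real.exp_le_one_iff.2 (neg_nonpos.2 (mul_nonneg hlpos.le x.2.1))
          have h2 : (x : ℝ) * (dist c c' * α⁻¹) ≤ L * (dist c c' * α⁻¹) :=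
            mul_le_mul_of_nonneg_right x.2.2 (by positivity)
          have h3 : 0 ≤ (x : ℝ) * (dist c c' * α⁻¹) := mul_nonneg x.2.1 (by positivity)
          calc _ ≤ 1 * (L * (dist c c' * α⁻¹)) := mul_le_mul h1 h2 h3 zero_le_one
            _ = _ := by ring
      · rw [NNReal.coe_mul, Real.coe_toNNReal _ (by positivity)]
        push_cast
        ring
    exact this.continuous
  refine ⟨fun c => lift (W c), fun c => (hlift _).continuousOn, fun c x hx => ?_, ?_⟩
  · have h1 : W c ⟨x, hx⟩ = Real.exp (-(l * x)) * ∫ t in (0 : ℝ)..x, H c (W c) t := by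
      conv_lhs => rw [← hW c]
      rfl
    change Real.exp (l * x) * W c (projIcc 0 L hL.le x) = _
    rw [projIcc_of_mem hL.le hx, h1, ← mul_assoc, ← Real.exp_add, add_neg_cancel, Real.exp_zero,
      one_mul]
  · exact continuous_const.mul ((continuous_eval_const (F := E) _).comp hWc)

/-- Existence for a bounded and Lipschitz continuous nonlinearity, by the shooting method. -/
theorem exists_isClassicalWeakSolution_of_lipschitzWith {L α β : ℝ} (hL : 0 < L) (hα : 0 < α)
    {a : ℝ → ℝ} (ha : IsCoefficient L α β a) (hαβ : α ≤ β) (g : L2 L) {φ : ℝ → ℝ} {K : NNReal}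
    (hφ : LipschitzWith K φ) {M : ℝ} (hM : ∀ s, |φ s| ≤ M) :
    ∃ z : H10 L, IsClassicalWeakSolution L a g φ z := by
  obtain ⟨u, hu, heq, hc⟩ := exists_initialValueProblem_solution hL hα ha (g := g) hφ
  have hβ : 0 < β := hα.trans_le hαβ
  let G : ℝ := ∫ x in Ioo 0 L, g x * (a x)⁻¹
  have hgi := integrable_mul_inv_coefficient hα ha (L2.integrable g)
  have hfi : ∀ c, Integrable (fun t => (c + φ (u c t)) * (a t)⁻¹) (intervalMeasure L) := fun c =>
    integrable_mul_inv_coefficient hα ha ((integrable_const c).add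
      ((memLp_of_continuousOn_Icc (hφ.continuous.comp_continuousOn (hu c)) 1).integrable le_rfl))
  have hval : ∀ c, u c L = (∫ t in Ioo 0 L, (c + φ (u c t)) * (a t)⁻¹) + G := by
    intro c
    rw [heq c L (right_mem_Icc.2 hL.le), ← integral_add (hfi c) hgi,
      setIntegral_Ioo_eq_intervalIntegral hL.le]
    simp only [add_mul]
  have hconst : ∀ d : ℝ, ∫ _ in Ioo 0 L, d = L * d := by
    intro d
    simp [hL.le]
  -- For this `c`, c + φ ≥ β|G|/L, and dividing by a ≤ β leaves at least |G|/L. The integral is thus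
  -- at least |G|, which outweighs the contribution `G` of `g`.
  have hpos : 0 ≤ u (M + β * |G| / L) L := by
    have : L * (|G| / L) ≤ ∫ t in Ioo 0 L,
        (M + β * |G| / L + φ (u (M + β * |G| / L) t)) * (a t)⁻¹ := by
      rw [← hconst]
      refine integral_mono_ae (integrable_const _) (hfi _) ?_
      filter_upwards [ha.2] with x hx
      have h1 := (abs_le.1 (hM (u (M + β * |G| / L) x))).1
      have h2 : 0 < a x := hα.trans_le hx.1
      simp only [← div_eq_mul_inv]
      rw [le_div_iff₀ h2]
      have h3 : |G| / L * a x ≤ |G| / L * β := mul_le_mul_of_nonneg_left hx.2 (by positivity)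
      have h4 : β * |G| / L = |G| / L * β := by ring
      linarith
    rw [mul_div_cancel₀ _ hL.ne'] at this
    rw [hval]
    linarith [neg_abs_le G]
  have hneg : u (-(M + β * |G| / L)) L ≤ 0 := by
    have : ∫ t in Ioo 0 L, (-(M + β * |G| / L) + φ (u (-(M + β * |G| / L)) t)) * (a t)⁻¹
        ≤ L * -(|G| / L) := by
      rw [← hconst]
      refine integral_mono_ae (hfi _) (integrable_const _) ?_
      filter_upwards [ha.2] with x hx
      have h1 := (abs_le.1 (hM (u (-(M + β * |G| / L)) x))).2
      have h2 : 0 < a x := hα.trans_le hx.1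
      simp only [← div_eq_mul_inv]
      rw [div_le_iff₀ h2]
      have h3 : |G| / L * a x ≤ |G| / L * β := mul_le_mul_of_nonneg_left hx.2 (by positivity)
      have h4 : β * |G| / L = |G| / L * β := by ring
      linarith
    rw [mul_neg, mul_div_cancel₀ _ hL.ne'] at this
    rw [hval]
    linarith [le_abs_self G]
  obtain ⟨c, hcL⟩ := mem_range_of_exists_le_of_exists_ge hc ⟨_, hneg⟩ ⟨_, hpos⟩
  exact exists_isClassicalWeakSolution_of_integral_eq hL hα ha hφ.continuous (hu c) (heq c) hcL

/-! ### Flux bound, compactness and existence for continuous nonlinearities. -/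

theorem L2.integral_abs_le {L : ℝ} (hL : 0 ≤ L) (v : L2 L) :
    ∫ x in Ioo 0 L, |v x| ≤ √L * ‖v‖ := by
  let X : L2 L := (memLp_const (1 : ℝ)).toLp _
  have hX : X =ᵐ[intervalMeasure L] fun _ => 1 := MemLp.coeFn_toLp _
  have hn : ‖X‖ = √L := by
    rw [norm_eq_sqrt_real_inner, ← L2.integral_mul_eq_inner]
    congr 1
    have : ∫ t in Ioo 0 L, X t * X t = ∫ t in Ioo 0 L, (1 : ℝ) := by
      refine integral_congr_ae ?_
      filter_upwards [hX] with t ht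
      rw [ht, mul_one]
    rw [this]
    simp [hL]
  have he : ∫ x in Ioo 0 L, |v x| = inner ℝ X |v| := by
    rw [← L2.integral_mul_eq_inner]
    refine integral_congr_ae ?_
    filter_upwards [hX, Lp.coeFn_abs v] with t ht hv
    rw [ht, hv, one_mul]
  rw [he, ← hn, ← norm_abs_eq_norm v]
  exact real_inner_le_norm _ _

/-- The constant flux is controlled by the values of the nonlinear term on any subinterval. -/
theorem abs_flux_mul_le {L α β : ℝ} (hα : 0 < α) (hαβ : α ≤ β) {a : ℝ → ℝ}
    (ha : IsCoefficient L α β a) {g : L2 L} {φ : ℝ → ℝ} {u : H10 L} {c : ℝ}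
    (h : ∀ᵐ x ∂intervalMeasure L, a x * H10.der u x = c + φ (H10.val u x) + g x)
    {x y M : ℝ} (hy : 0 ≤ y) (hyx : y < x) (hx : x ≤ L)
    (hM : ∀ t ∈ Ioo y x, |φ (H10.rep u t)| ≤ M) :
    |c| * (x - y) ≤ √L * (β * ‖H10.der u‖ + ‖g‖) + M * (x - y) := by
  have hL : 0 < L := (hy.trans_lt hyx).trans_le hx
  have hβ : 0 < β := hα.trans_le hαβ
  have hsub : Ioo y x ⊆ Ioo 0 L := Ioo_subset_Ioo hy hx
  have hd : Integrable (fun t => |H10.der u t|) (intervalMeasure L) := (L2.integrable _).abs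
  have hg : Integrable (fun t => |g t|) (intervalMeasure L) := (L2.integrable _).abs
  have hd' : IntegrableOn (fun t => β * |H10.der u t|) (Ioo y x) :=
    (Integrable.const_mul hd β).mono_measure (Measure.restrict_mono hsub le_rfl)
  have hg' : IntegrableOn (fun t => |g t|) (Ioo y x) :=
    hg.mono_measure (Measure.restrict_mono hsub le_rfl)
  have hdg : IntegrableOn (fun t => β * |H10.der u t| + |g t|) (Ioo y x) := hd'.add hg'
  have hc (d : ℝ) : ∫ _ in Ioo y x, d = d * (x - y) := by simp [hyx.le, mul_comm]
  -- A constant is controlled by its integral over any subinterval, so it suffices to bound the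
  -- nonlinear term there.
  have hae : ∀ᵐ t ∂volume.restrict (Ioo y x), |c| ≤ β * |H10.der u t| + |g t| + M := by
    filter_upwards [ae_restrict_of_ae_restrict_of_subset hsub h,
      ae_restrict_of_ae_restrict_of_subset hsub (H10.val_ae_eq_rep hL u),
      ae_restrict_of_ae_restrict_of_subset hsub ha.2, ae_restrict_mem measurableSet_Ioo]
      with t h1 h2 h3 h4
    have hφ := hM t h4
    rw [← h2] at hφ
    have e : c = a t * H10.der u t - φ (H10.val u t) - g t := by linarith
    have h5 : |a t * H10.der u t| ≤ β * |H10.der u t| := by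
      rw [abs_mul, abs_of_pos (hα.trans_le h3.1)]
      exact mul_le_mul_of_nonneg_right h3.2 (abs_nonneg _)
    rw [e]
    have := abs_sub (a t * H10.der u t - φ (H10.val u t)) (g t)
    have := abs_sub (a t * H10.der u t) (φ (H10.val u t))
    linarith
  calc |c| * (x - y) = ∫ _ in Ioo y x, |c| := (hc _).symm
    _ ≤ ∫ t in Ioo y x, (β * |H10.der u t| + |g t| + M) :=
      integral_mono_ae (integrable_const _) (hdg.add (integrable_const _)) hae
    _ = (∫ t in Ioo y x, (β * |H10.der u t| + |g t|)) + M * (x - y) := by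
      rw [integral_add hdg (integrable_const _), hc]
    _ ≤ (∫ t in Ioo 0 L, (β * |H10.der u t| + |g t|)) + M * (x - y) := by
      refine add_le_add (setIntegral_mono_set ((hd.const_mul β).add hg)
        (ae_of_all _ fun t => ?_) (ae_of_all _ hsub)) le_rfl
      exact add_nonneg (mul_nonneg hβ.le (abs_nonneg _)) (abs_nonneg _)
    _ = β * (∫ t in Ioo 0 L, |H10.der u t|) + (∫ t in Ioo 0 L, |g t|) + M * (x - y) := by
      rw [integral_add (hd.const_mul β) hg, integral_const_mul]
    _ ≤ β * (√L * ‖H10.der u‖) + √L * ‖g‖ + M * (x - y) := by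
      gcongr
      · exact L2.integral_abs_le hL.le _
      · exact L2.integral_abs_le hL.le _
    _ = _ := by ring

theorem H10.abs_rep_le {L : ℝ} (hL : 0 ≤ L) (u : H10 L) {x : ℝ} (hx : x ∈ Icc 0 L) :
    |rep u x| ≤ √L * ‖u‖ := by
  have h := abs_rep_sub_rep_le u hx (left_mem_Icc.2 hL)
  rw [rep_zero, sub_zero, sub_zero] at h
  refine h.trans (mul_le_mul_of_nonneg_right (Real.sqrt_le_sqrt ?_) (norm_nonneg _))
  rw [abs_of_nonneg hx.1]
  exact hx.2

/-- Bounded sets of `H¹₀(0, L)` are relatively compact for the uniform convergence. -/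
theorem H10.exists_subseq_tendsto_rep {L : ℝ} (hL : 0 ≤ L) {u : ℕ → H10 L} {N : ℝ}
    (hu : ∀ n, ‖u n‖ ≤ N) :
    ∃ (v : ℝ → ℝ) (ns : ℕ → ℕ), ContinuousOn v (Icc 0 L) ∧ StrictMono ns ∧
      ∀ x ∈ Icc 0 L, Tendsto (fun k => rep (u (ns k)) x) atTop (𝓝 (v x)) := by
  have hN : 0 ≤ N := (norm_nonneg _).trans (hu 0)
  let w : ℕ → BoundedContinuousFunction (Icc (0 : ℝ) L) ℝ := fun n =>
    BoundedContinuousFunction.mkOfCompact ⟨fun x => rep (u n) x,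
      continuousOn_iff_continuous_domRestrict.1 (continuousOn_rep hL (u n))⟩
  have hA : IsCompact (closure (range w)) := by
    refine BoundedContinuousFunction.arzela_ascoli (Icc (-(√L * N)) (√L * N)) isCompact_Icc _ ?_ ?_
    · rintro _ x ⟨n, rfl⟩
      refine abs_le.1 ((abs_rep_le hL (u n) x.2).trans ?_)
      exact mul_le_mul_of_nonneg_left (hu n) (Real.sqrt_nonneg _)
    · refine Metric.equicontinuous_of_continuity_modulus (fun d => √d * N) ?_ _ ?_
      · have : Continuous fun d : ℝ => √d * N := by fun_prop
        simpa using this.tendsto 0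
      · rintro x y ⟨_, n, rfl⟩
        refine (abs_rep_sub_rep_le (u n) x.2 y.2).trans ?_
        exact mul_le_mul_of_nonneg_left (hu n) (Real.sqrt_nonneg _)
  obtain ⟨v, -, ns, hns, hv⟩ := hA.tendsto_subseq fun n => subset_closure (mem_range_self n)
  refine ⟨fun x => v (projIcc 0 L hL x), ns,
    (v.continuous.comp continuous_projIcc).continuousOn, hns, fun x hx => ?_⟩
  have h := ((continuous_eval_const (F := BoundedContinuousFunction (Icc (0 : ℝ) L) ℝ)
    (⟨x, hx⟩ : Icc (0 : ℝ) L)).tendsto v).comp hv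
  beta_reduce
  rw [projIcc_of_mem hL hx]
  exact h

/-- Existence of a classical weak solution for any continuous nonlinearity. -/
theorem exists_isClassicalWeakSolution {L α β : ℝ} (hL : 0 < L) (hα : 0 < α) (hαβ : α ≤ β)
    {a : ℝ → ℝ} (ha : IsCoefficient L α β a) (g : L2 L) {φ : ℝ → ℝ} (hφ : Continuous φ) :
    ∃ z : H10 L, IsClassicalWeakSolution L a g φ z := by
  have h0L := left_mem_Icc.2 hL.le
  -- `R` bounds every solution uniformly and does not depend on the nonlinearity, so `φ` matters
  -- only on [-R, R].
  set R : ℝ := √L * (‖g‖ / α) with hR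
  have hR0 : 0 ≤ R := by positivity
  have hRR : -R ≤ R := by linarith
  obtain ⟨M, hM⟩ := isCompact_Icc.exists_bound_of_continuousOn (hφ.continuousOn (s := Icc (-R) R))
  have happ : ∀ k : ℕ, ∃ (ψ : ℝ → ℝ) (K : NNReal), LipschitzWith K ψ ∧ (∀ s, |ψ s| ≤ M + 1) ∧
      ∀ s ∈ Icc (-R) R, |ψ s - φ s| < 1 / ((k : ℝ) + 1) := by
    intro k
    obtain ⟨p, hp⟩ := exists_polynomial_near_of_continuousOn (-R) R φ hφ.continuousOn
      (1 / ((k : ℝ) + 1)) (by positivity)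
    have hpd : ContDiffOn ℝ 1 (fun s => p.eval s) (Icc (-R) R) := by
      simpa [Polynomial.coe_aeval_eq_eval] using (p.contDiff_aeval (𝕜 := ℝ) 1).contDiffOn
    obtain ⟨K, hK⟩ := hpd.exists_lipschitzOnWith one_ne_zero (convex_Icc _ _) isCompact_Icc
    -- A Weierstrass polynomial on [-R, R], continued by its end values, is globally bounded and
    -- Lipschitz.
    refine ⟨IccExtend hRR ((Icc (-R) R).domRestrict fun s => p.eval s), K,
      ((LipschitzOnWith.to_restrict hK).comp (LipschitzWith.projIcc hRR)).weaken (by simp),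
      fun s => ?_, fun s hs => ?_⟩
    · have hs := (projIcc (-R) R hRR s).2
      have h1 := hp _ hs
      have h2 := hM _ hs
      have h3 : 1 / ((k : ℝ) + 1) ≤ 1 := by
        rw [div_le_one (by positivity)]
        linarith [k.cast_nonneg (α := ℝ)]
      have h4 := abs_add_le (p.eval (projIcc (-R) R hRR s : ℝ) - φ (projIcc (-R) R hRR s))
        (φ (projIcc (-R) R hRR s))
      rw [sub_add_cancel] at h4
      rw [Real.norm_eq_abs] at h2
      change |p.eval (projIcc (-R) R hRR s : ℝ)| ≤ M + 1
      linarith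
    · rw [IccExtend_of_mem _ _ hs]
      exact hp s hs
  choose ψ K hψK hψM hψφ using happ
  choose u hu using fun k =>
    exists_isClassicalWeakSolution_of_lipschitzWith hL hα ha hαβ g (hψK k) (hψM k)
  have hun : ∀ k, ‖u k‖ ≤ ‖g‖ / α := fun k => (hu k).norm_der_le hL hα ha (hψK k).continuous
  choose c hc using fun k => (hu k).exists_flux_eq hL ha (hψK k).continuous
  have hcb : ∀ k, |c k| ≤ (√L * (β * (‖g‖ / α) + ‖g‖) + (M + 1) * L) / L := by
    intro k
    have h := abs_flux_mul_le hα hαβ ha (hc k) le_rfl hL le_rfl fun t _ => hψM k _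
    rw [sub_zero] at h
    rw [le_div_iff₀ hL]
    refine h.trans ?_
    have := hα.trans_le hαβ
    gcongr
    exact hun k
  obtain ⟨v, ns, hv, hns, hlim⟩ := H10.exists_subseq_tendsto_rep hL.le hun
  obtain ⟨c', -, ms, hms, hc'⟩ := tendsto_subseq_of_bounded
    (Metric.isBounded_closedBall (x := (0 : ℝ))
      (r := (√L * (β * (‖g‖ / α) + ‖g‖) + (M + 1) * L) / L))
    (x := fun k => c (ns k)) (fun k => by simpa using hcb (ns k))
  set js : ℕ → ℕ := fun k => ns (ms k) with hjs
  have hjst : Tendsto js atTop atTop := hns.tendsto_atTop.comp hms.tendsto_atTop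
  have hlim' : ∀ x ∈ Icc 0 L, Tendsto (fun k => H10.rep (u (js k)) x) atTop (𝓝 (v x)) :=
    fun x hx => (hlim x hx).comp hms.tendsto_atTop
  have hmem : ∀ k, ∀ x ∈ Icc 0 L, H10.rep (u k) x ∈ Icc (-R) R := fun k x hx =>
    abs_le.1 ((H10.abs_rep_le hL.le (u k) hx).trans
      (mul_le_mul_of_nonneg_left (hun k) (Real.sqrt_nonneg _)))
  have hψlim : ∀ x ∈ Icc 0 L,
      Tendsto (fun k => ψ (js k) (H10.rep (u (js k)) x)) atTop (𝓝 (φ (v x))) := by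
    intro x hx
    have h1 : Tendsto (fun k => ψ (js k) (H10.rep (u (js k)) x) - φ (H10.rep (u (js k)) x)) atTop
        (𝓝 0) := by
      refine squeeze_zero_norm (fun k => (hψφ (js k) _ (hmem _ x hx)).le) ?_
      exact tendsto_one_div_add_atTop_nhds_zero_nat.comp hjst
    have h2 := h1.add ((hφ.tendsto _).comp (hlim' x hx))
    simpa using h2
  refine exists_isClassicalWeakSolution_of_integral_eq hL hα ha hφ hv (c := c')
    (fun x hx => ?_) ?_
  -- Both sides of the integrated equation converge, the right one by dominated convergence: the
  -- fluxes and the `ψ k` have bounds independent of `k`.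
  · refine tendsto_nhds_unique (hlim' x hx) ?_
    simp only [H10.rep]
    rw [intervalIntegral.integral_of_le hx.1, integral_Ioc_eq_integral_Ioo]
    have hsub : Ioo 0 x ⊆ Ioo 0 L := Ioo_subset_Ioo_right hx.2
    have hred : ∀ k, ∫ t in (0 : ℝ)..x, H10.der (u (js k)) t = ∫ t in Ioo 0 x,
        (c (js k) + ψ (js k) (H10.rep (u (js k)) t) + g t) * (a t)⁻¹ := by
      intro k
      rw [intervalIntegral.integral_of_le hx.1, integral_Ioc_eq_integral_Ioo]
      refine integral_congr_ae (ae_restrict_of_ae_restrict_of_subset hsub ?_)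
      filter_upwards [hc (js k), ha.2, H10.val_ae_eq_rep hL (u (js k))] with t h1 h2 h3
      have : a t ≠ 0 := (hα.trans_le h2.1).ne'
      rw [← h3, ← h1]
      field_simp
    simp only [hred]
    set B : ℝ := (√L * (β * (‖g‖ / α) + ‖g‖) + (M + 1) * L) / L
    refine tendsto_integral_of_dominated_convergence (fun t => (B + (M + 1) + |g t|) * α⁻¹)
      (fun k => ?_) ?_ (fun k => ?_) ?_
    · refine AEStronglyMeasurable.mono_measure ?_ (Measure.restrict_mono hsub le_rfl)
      refine ((AEStronglyMeasurable.add aestronglyMeasurable_const ?_).add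
        (Lp.aestronglyMeasurable g)).mul ha.1.inv₀
      exact (memLp_of_continuousOn_Icc ((hψK (js k)).continuous.comp_continuousOn
        (H10.continuousOn_rep hL.le (u (js k)))) 1).1
    · refine Integrable.mono_measure ?_ (Measure.restrict_mono hsub le_rfl)
      exact ((integrable_const _).add (L2.integrable g).abs).mul_const _
    · refine ae_restrict_of_ae_restrict_of_subset hsub ?_
      filter_upwards [ha.2] with t ht
      rw [norm_mul, Real.norm_eq_abs, Real.norm_eq_abs,
        abs_of_nonneg (inv_nonneg.2 (hα.le.trans ht.1))]
      refine mul_le_mul ?_ (inv_anti₀ hα ht.1) (inv_nonneg.2 (hα.le.trans ht.1)) ?_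
      · refine (abs_add_le _ _).trans (add_le_add ((abs_add_le _ _).trans ?_) le_rfl)
        exact add_le_add (hcb _) (hψM _ _)
      · have h1 := (abs_nonneg _).trans (hcb 0)
        have h2 := (abs_nonneg _).trans (hψM 0 0)
        positivity
    · filter_upwards [ae_restrict_mem measurableSet_Ioo] with t ht
      have htI : t ∈ Icc 0 L := Ioo_subset_Icc_self (hsub ht)
      exact ((hc'.add (hψlim t htI)).add_const _).mul_const _
  · refine tendsto_nhds_unique (hlim' L (right_mem_Icc.2 hL.le)) ?_
    simp only [H10.rep_right hL]
    exact tendsto_const_nhds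

/-! ### Weak convergence in H¹₀ and convergence of the nonlinearities. -/

theorem TendstoWeakly.tendsto_apply {E : Type*} [NormedAddCommGroup E] [NormedSpace ℝ E]
    {u : ℕ → E} {v : E} (h : TendstoWeakly u v) (f : E →L[ℝ] ℝ) :
    Tendsto (fun n => f (u n)) atTop (𝓝 (f v)) :=
  ((WeakBilin.eval_continuous (topDualPairing ℝ E).flip f).tendsto _).comp h

namespace H10

theorem tendsto_inner_der {L : ℝ} {u : ℕ → H10 L} {v : H10 L} (h : TendstoWeakly u v) (y : L2 L) :
    Tendsto (fun n => (inner ℝ y (der (u n)) : ℝ)) atTop (𝓝 (inner ℝ y (der v))) :=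
  h.tendsto_apply ((innerSL ℝ y).comp (der.mkContinuous 1 fun u => by rw [one_mul, norm_eq]))

/-- Evaluation of the representative at a point is a continuous linear functional, by `abs_rep_le`.
-/
theorem tendsto_rep {L : ℝ} {u : ℕ → H10 L} {v : H10 L} (h : TendstoWeakly u v) {x : ℝ}
    (hx : x ∈ Icc 0 L) : Tendsto (fun n => rep (u n) x) atTop (𝓝 (rep v x)) := by
  have hL := hx.1.trans hx.2
  have h0 := left_mem_Icc.2 hL
  have hi (u : H10 L) := intervalIntegrable_of_integrable_Ioo (L2.integrable (der u)) h0 hx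
  have hcongr {f g : ℝ → ℝ} (hfg : f =ᵐ[intervalMeasure L] g) :
      ∫ t in (0 : ℝ)..x, f t = ∫ t in (0 : ℝ)..x, g t := by
    rw [intervalIntegral.integral_of_le hx.1, intervalIntegral.integral_of_le hx.1,
      integral_Ioc_eq_integral_Ioo, integral_Ioc_eq_integral_Ioo]
    exact integral_congr_ae
      (ae_restrict_of_ae_restrict_of_subset (Ioo_subset_Ioo_right hx.2) hfg)
  let ev : H10 L →ₗ[ℝ] ℝ :=
    { toFun := fun u => rep u x
      map_add' := fun u v => by
        rw [rep, rep, rep, ← intervalIntegral.integral_add (hi u) (hi v), map_add]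
        exact hcongr (Lp.coeFn_add _ _)
      map_smul' := fun c u => by
        rw [rep, rep, map_smul, hcongr (Lp.coeFn_smul _ _)]
        exact intervalIntegral.integral_const_mul c _ }
  exact h.tendsto_apply (ev.mkContinuous (√L) fun u => abs_rep_le hL u hx)

theorem exists_rep_ne_zero {L : ℝ} (hL : 0 < L) {u : H10 L} (hu : u ≠ 0) :
    ∃ x ∈ Ioo 0 L, rep u x ≠ 0 := by
  by_contra! h
  refine hu (der_injective L ?_)
  rw [map_zero, Lp.eq_zero_iff_ae_eq_zero]
  filter_upwards [ae_restrict_of_ae (ae_hasDerivAt_rep hL.le u), ae_restrict_mem measurableSet_Ioo]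
    with x h1 h2
  have h3 : rep u =ᶠ[𝓝 x] fun _ => 0 := by
    filter_upwards [isOpen_Ioo.mem_nhds h2] with y hy
    exact h y hy
  exact (h1 (Ioo_subset_Icc_self h2)).unique ((hasDerivAt_const x 0).congr_of_eventuallyEq h3)

end H10

/-- Sequential continuous convergence implies joint convergence. -/
theorem IsReasonableApprox.tendsto_prod {φ : ℝ → EReal} {φn : ℕ → ℝ → EReal}
    (h : IsReasonableApprox φ φn) (t : ℝ) :
    Tendsto (fun p : ℕ × ℝ => φn p.1 p.2) (atTop ×ˢ 𝓝 t) (𝓝 (φ t)) := by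
  refine tendsto_of_subseq_tendsto fun ps hps => ?_
  rw [tendsto_prod_iff'] at hps
  obtain ⟨ms, hms, hj⟩ := strictMono_subseq_of_tendsto_atTop hps.1
  set j : ℕ → ℕ := fun k => (ps (ms k)).1
  have hj' : StrictMono j := hj
  -- The hypothesis concerns full sequences only, so the values along the indices `j` are completed
  -- by the limit `t` at the missing indices.
  let s : ℕ → ℝ := Function.extend j (fun k => (ps (ms k)).2) fun _ => t
  have hs : Tendsto s atTop (𝓝 t) := by
    rw [tendsto_def]
    intro U hU
    obtain ⟨k₀, hk₀⟩ := eventually_atTop.1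
      ((hps.2.comp hms.tendsto_atTop).eventually (eventually_mem_set.2 hU))
    refine eventually_atTop.2 ⟨j k₀, fun n hn => ?_⟩
    by_cases hex : ∃ k, j k = n
    · obtain ⟨k, rfl⟩ := hex
      simp only [s, hj'.injective.extend_apply]
      exact hk₀ k (hj'.le_iff_le.1 hn)
    · simp only [s, Function.extend_apply' _ _ _ hex]
      exact mem_of_mem_nhds hU
  refine ⟨ms, ?_⟩
  have := (h.tendsto s t hs).comp hj'.tendsto_atTop
  refine this.congr fun k => ?_
  simp only [Function.comp_apply, s, hj'.injective.extend_apply]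
  rfl

/-- The approximations are eventually uniformly bounded on the compact sets where the limit is
finite. -/
theorem exists_eventually_forall_abs_le {φ : ℝ → EReal} {f : ℕ → ℝ → ℝ}
    (h : ∀ t, Tendsto (fun p : ℕ × ℝ => (f p.1 p.2 : EReal)) (atTop ×ˢ 𝓝 t) (𝓝 (φ t)))
    {K : Set ℝ} (hK : IsCompact K) (hb : ∀ t ∈ K, φ t ≠ ⊥) (ht : ∀ t ∈ K, φ t ≠ ⊤) :
    ∃ C : ℝ, ∀ᶠ n in atTop, ∀ s ∈ K, |f n s| ≤ C := by
  refine hK.induction_on (p := fun S => ∃ C : ℝ, ∀ᶠ n in atTop, ∀ s ∈ S, |f n s| ≤ C)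
    ⟨0, by simp⟩ ?_ ?_ ?_
  · rintro S T hST ⟨C, hC⟩
    exact ⟨C, hC.mono fun n hn s hs => hn s (hST hs)⟩
  · rintro S T ⟨C, hC⟩ ⟨D, hD⟩
    refine ⟨max C D, ?_⟩
    filter_upwards [hC, hD] with n h1 h2 s hs
    rcases hs with hs | hs
    · exact (h1 s hs).trans (le_max_left _ _)
    · exact (h2 s hs).trans (le_max_right _ _)
  · intro t htK
    have h1 := h t
    rw [← EReal.coe_toReal (ht t htK) (hb t htK), EReal.tendsto_coe] at h1
    have h2 := h1.abs.eventually_le_const (lt_add_one _)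
    obtain ⟨pa, hpa, pb, hpb, hab⟩ := eventually_prod_iff.1 h2
    refine ⟨{s | pb s}, mem_nhdsWithin_of_mem_nhds hpb, |(φ t).toReal| + 1, ?_⟩
    filter_upwards [hpa] with n hn s hs
    exact hab hn hs

/-! ### Bounded fluxes and passage to the limit. -/

/-- A sequence of solutions with a nonzero weak limit has bounded fluxes. -/
theorem exists_abs_flux_le {L α β : ℝ} (hL : 0 < L) (hα : 0 < α) (hαβ : α ≤ β) {φ : ℝ → EReal}
    (hφ : IsNonlinearity φ) {f : ℕ → ℝ → ℝ}
    (h : ∀ t, Tendsto (fun p : ℕ × ℝ => (f p.1 p.2 : EReal)) (atTop ×ˢ 𝓝 t) (𝓝 (φ t)))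
    {b : ℕ → ℝ → ℝ} (hb : ∀ k, IsCoefficient L α β (b k)) {q : ℕ → L2 L} {G : ℝ}
    (hq : ∀ k, ‖q k‖ ≤ G) {w : ℕ → H10 L} {N : ℝ} (hN : ∀ k, ‖w k‖ ≤ N) {c : ℕ → ℝ}
    (hc : ∀ k, ∀ᵐ x ∂intervalMeasure L,
      b k x * H10.der (w k) x = c k + f k (H10.val (w k) x) + q k x)
    {u : H10 L} (hu : u ≠ 0) (hw : TendstoWeakly w u) :
    ∃ B : ℝ, ∀ k, |c k| ≤ B := by
  have hβ : 0 < β := hα.trans_le hαβ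
  have hN0 : 0 ≤ N := (norm_nonneg _).trans (hN 0)
  obtain ⟨x, hx, hxu⟩ := H10.exists_rep_ne_zero hL hu
  have hxI := Ioo_subset_Icc_self hx
  -- Convergence at `x` costs `d`, the oscillation over [x, x + η] costs another `d`; the values
  -- stay in a ball of radius `2 * d`, which avoids 0.
  set d : ℝ := |H10.rep u x| / 4 with hd
  have hd0 : 0 < d := by positivity
  set η : ℝ := min (L - x) ((d / (N + 1)) ^ 2) with hη
  have hη0 : 0 < η := lt_min (sub_pos.2 hx.2) (by positivity)
  have hηN : √η * N ≤ d := by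
    have h1 : √η ≤ d / (N + 1) := Real.sqrt_le_iff.2 ⟨by positivity, min_le_right _ _⟩
    calc √η * N ≤ d / (N + 1) * N := by gcongr
      _ ≤ d / (N + 1) * (N + 1) := by gcongr; linarith
      _ = d := by field_simp
  have hηL : x + η ≤ L := by linarith [min_le_left (L - x) ((d / (N + 1)) ^ 2)]
  have hK : ∀ t ∈ Metric.closedBall (H10.rep u x) (2 * d), t ≠ 0 := by
    rintro t ht rfl
    rw [Metric.mem_closedBall, Real.dist_eq, zero_sub, abs_neg] at ht
    linarith
  obtain ⟨C, hC⟩ := exists_eventually_forall_abs_le h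
    (isCompact_closedBall (H10.rep u x) (2 * d)) (fun t _ => hφ.ne_bot t)
    (fun t ht => hφ.ne_top t (hK t ht))
  have hev : ∀ᶠ k in atTop, |c k| ≤ (√L * (β * N + G) + C * η) / η := by
    filter_upwards [hC, (H10.tendsto_rep hw hxI).eventually (Metric.closedBall_mem_nhds _ hd0)]
      with k h1 h2
    rw [le_div_iff₀ hη0]
    have h3 := abs_flux_mul_le hα hαβ (hb k) (hc k) (x := x + η) (y := x) (M := C) hx.1.le
      (by linarith) hηL fun t ht => h1 _ ?_
    · rw [add_sub_cancel_left] at h3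
      refine h3.trans ?_
      gcongr
      · exact hN k
      · exact hq k
    · have h4 := H10.abs_rep_sub_rep_le (w k) (x := t) (y := x)
        ⟨hx.1.le.trans ht.1.le, ht.2.le.trans hηL⟩ hxI
      have h5 : √|t - x| * ‖w k‖ ≤ √η * N := by
        gcongr
        · rw [abs_of_pos (by linarith [ht.1])]
          linarith [ht.2]
        · exact hN k
      rw [Real.dist_eq] at h2
      rw [Metric.mem_closedBall, Real.dist_eq]
      have h6 := abs_sub_le (H10.rep (w k) t) (H10.rep (w k) x) (H10.rep u x)
      linarith
  -- The finitely many remaining indices only enlarge the bound.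
  obtain ⟨B, hB⟩ := Filter.IsBoundedUnder.bddAbove_range
    (⟨_, eventually_map.2 hev⟩ : IsBoundedUnder (· ≤ ·) atTop fun k => |c k|)
  exact ⟨B, fun k => hB (mem_range_self k)⟩

theorem L2.integral_mul_self {L : ℝ} (v : L2 L) : ∫ x in Ioo 0 L, v x * v x = ‖v‖ ^ 2 := by
  rw [L2.integral_mul_eq_inner, real_inner_self_eq_norm_sq]

/-- A sequence which is bounded in `L²(0, L)` and converges to zero almost everywhere converges to
zero in `L¹(0, L)`. -/
theorem L2.tendsto_integral_abs_zero {L : ℝ} {r : ℕ → L2 L} {D : ℝ} (hD : ∀ k, ‖r k‖ ≤ D)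
    (h : ∀ᵐ x ∂intervalMeasure L, Tendsto (fun k => r k x) atTop (𝓝 0)) :
    Tendsto (fun k => ∫ x in Ioo 0 L, |r k x|) atTop (𝓝 0) := by
  rw [Metric.tendsto_atTop']
  intro ε hε
  -- Since |r| ≤ min(|r|, M) + r²/M, the truncated part tends to zero by dominated convergence and
  -- the rest is at most D²/M < ε/2.
  set M : ℝ := 2 * (D ^ 2 + 1) / ε with hM
  have hM0 : 0 < M := by positivity
  have hmeas : ∀ k, AEStronglyMeasurable (fun x => min |r k x| M) (intervalMeasure L) := fun k =>
    ((Lp.aestronglyMeasurable (r k)).norm).inf aestronglyMeasurable_const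
  have hbd : ∀ k x, ‖min |r k x| M‖ ≤ M := fun k x => by
    rw [Real.norm_eq_abs, abs_of_nonneg (le_min (abs_nonneg _) hM0.le)]
    exact min_le_right _ _
  have hmin : Tendsto (fun k => ∫ x in Ioo 0 L, min |r k x| M) atTop (𝓝 0) := by
    have := tendsto_integral_of_dominated_convergence (μ := intervalMeasure L)
      (F := fun k x => min |r k x| M) (f := fun _ => 0) (fun _ => M) hmeas (integrable_const _)
      (fun k => ae_of_all _ (hbd k)) (by
        filter_upwards [h] with x hx
        have := hx.abs.min (tendsto_const_nhds (x := M))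
        simpa [hM0.le] using this)
    simpa using this
  obtain ⟨k₀, hk₀⟩ := (Metric.tendsto_atTop'.1 hmin) (ε / 2) (by positivity)
  refine ⟨k₀, fun k hk => ?_⟩
  have h1 := hk₀ k hk
  rw [dist_zero_right, Real.norm_eq_abs] at h1 ⊢
  rw [abs_of_nonneg (integral_nonneg fun x => abs_nonneg _)]
  have hm : MemLp (fun x => r k x) 2 (intervalMeasure L) := Lp.memLp _
  have i1 : Integrable (fun x => r k x * r k x) (intervalMeasure L) := hm.integrable_mul hm
  have i2 : Integrable (fun x => min |r k x| M) (intervalMeasure L) :=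
    (integrable_const M).mono' (hmeas k) (ae_of_all _ (hbd k))
  calc ∫ x in Ioo 0 L, |r k x|
      ≤ ∫ x in Ioo 0 L, (min |r k x| M + r k x * r k x * M⁻¹) := by
        refine integral_mono (L2.integrable (r k)).abs (i2.add (i1.mul_const _)) fun x => ?_
        change |r k x| ≤ min |r k x| M + r k x * r k x * M⁻¹
        have h0 : 0 ≤ r k x * r k x * M⁻¹ := mul_nonneg (mul_self_nonneg _) (inv_nonneg.2 hM0.le)
        rcases le_total |r k x| M with h2 | h2
        · rw [min_eq_left h2]
          linarith
        · rw [min_eq_right h2, ← abs_mul_abs_self]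
          have : |r k x| ≤ |r k x| * |r k x| * M⁻¹ := by
            rw [← div_eq_mul_inv, le_div_iff₀ hM0]
            exact mul_le_mul_of_nonneg_left h2 (abs_nonneg _)
          linarith
    _ = (∫ x in Ioo 0 L, min |r k x| M) + ‖r k‖ ^ 2 * M⁻¹ := by
        rw [integral_add i2 (i1.mul_const _), integral_mul_const, L2.integral_mul_self]
    _ < ε / 2 + ε / 2 := by
        refine add_lt_add ((le_abs_self _).trans_lt h1) ?_
        rw [← div_eq_mul_inv, div_lt_iff₀ hM0, hM]
        have h3 : ‖r k‖ ^ 2 ≤ D ^ 2 := pow_le_pow_left₀ (norm_nonneg _) (hD k) 2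
        have h4 : ε / 2 * (2 * (D ^ 2 + 1) / ε) = D ^ 2 + 1 := by field_simp
        linarith
    _ = ε := by ring

/-- A sequence which is bounded in `L²(0, L)` and converges almost everywhere in `ℝ ∪ {+∞}` has a
limit in `L²(0, L)`. -/
theorem L2.exists_ae_tendsto {L : ℝ} {p : ℕ → L2 L} {D : ℝ} (hD : ∀ k, ‖p k‖ ≤ D) {q : ℝ → EReal}
    (hq : ∀ x, q x ≠ ⊥)
    (h : ∀ᵐ x ∂intervalMeasure L, Tendsto (fun k => (p k x : EReal)) atTop (𝓝 (q x))) :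
    ∃ W : L2 L, (∀ᵐ x ∂intervalMeasure L, q x = (W x : EReal)) ∧
      ∀ᵐ x ∂intervalMeasure L, Tendsto (fun k => p k x) atTop (𝓝 (W x)) := by
  have hnorm : ∀ k, eLpNorm (p k) 2 (intervalMeasure L) ≤ ENNReal.ofReal D := by
    intro k
    rw [← ENNReal.ofReal_toReal (Lp.eLpNorm_ne_top (p k)), ← Lp.norm_def]
    exact ENNReal.ofReal_le_ofReal (hD k)
  have hsq : ∀ k, ∫⁻ x in Ioo 0 L, ‖p k x‖ₑ ^ (2 : ℝ) ≤ ENNReal.ofReal D ^ (2 : ℝ) := by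
    intro k
    have h1 := ENNReal.rpow_le_rpow (hnorm k) (zero_le_two (α := ℝ))
    rwa [eLpNorm_eq_lintegral_rpow_enorm_toReal two_ne_zero ENNReal.ofNat_ne_top,
      ENNReal.toReal_ofNat, ← ENNReal.rpow_mul, one_div, inv_mul_cancel₀ two_ne_zero,
      ENNReal.rpow_one] at h1
  have hae : ∀ k, Measurable fun x => ‖p k x‖ₑ ^ (2 : ℝ) := fun k =>
    (Lp.stronglyMeasurable (p k)).measurable.enorm.pow_const _
  -- By Fatou the lower limit of |p k|² is integrable, hence finite a.e.; this rules out the value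
  -- +∞ for `q`.
  have hfin : ∀ᵐ x ∂intervalMeasure L,
      liminf (fun k => ‖p k x‖ₑ ^ (2 : ℝ)) atTop < ⊤ := by
    refine ae_lt_top (Measurable.liminf hae) (ne_top_of_le_ne_top
      (b := ENNReal.ofReal D ^ (2 : ℝ)) (by simp) ?_)
    refine (lintegral_liminf_le hae).trans ?_
    exact liminf_le_of_le (by isBoundedDefault) fun b hb =>
      (hb.exists.choose_spec).trans (hsq _)
  have htop : ∀ᵐ x ∂intervalMeasure L, q x ≠ ⊤ := by
    filter_upwards [hfin, h] with x h1 h2 h3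
    rw [h3, EReal.tendsto_coe_nhds_top_iff] at h2
    have h4 : Tendsto (fun k => ‖p k x‖ₑ ^ (2 : ℝ)) atTop (𝓝 ⊤) := by
      have h5 : Tendsto (fun k => ‖p k x‖ₑ) atTop (𝓝 ⊤) := by
        have := ENNReal.tendsto_ofReal_atTop.comp (tendsto_abs_atTop_atTop.comp h2)
        refine this.congr fun k => ?_
        simp only [Function.comp_apply, ← Real.norm_eq_abs, ofReal_norm]
      have h6 := (ENNReal.continuous_rpow_const (y := 2)).tendsto ⊤
      rw [ENNReal.top_rpow_of_pos zero_lt_two] at h6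
      exact h6.comp h5
    exact h1.ne h4.liminf_eq
  have hlim : ∀ᵐ x ∂intervalMeasure L, Tendsto (fun k => p k x) atTop (𝓝 (q x).toReal) := by
    filter_upwards [h, htop] with x h1 h2
    rwa [← EReal.coe_toReal h2 (hq x), EReal.tendsto_coe] at h1
  have hmem : MemLp (fun x => (q x).toReal) 2 (intervalMeasure L) := by
    refine ⟨aestronglyMeasurable_of_tendsto_ae atTop
      (fun k => Lp.aestronglyMeasurable (p k)) hlim, ?_⟩
    refine (Lp.eLpNorm_lim_le_liminf_eLpNorm (fun k => Lp.aestronglyMeasurable (p k)) _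
      hlim).trans_lt ?_
    refine lt_of_le_of_lt ?_ (ENNReal.ofReal_lt_top (r := D))
    exact liminf_le_of_le (by isBoundedDefault) fun b hb =>
      (hb.exists.choose_spec).trans (hnorm _)
  refine ⟨hmem.toLp _, ?_, ?_⟩
  · filter_upwards [htop, hmem.coeFn_toLp] with x h1 h2
    rw [h2, EReal.coe_toReal h1 (hq x)]
  · filter_upwards [hlim, hmem.coeFn_toLp] with x h1 h2
    rwa [h2]

/-- As `χ` is bounded, the L¹ convergence of `p k - W` to zero is enough. -/
theorem L2.tendsto_integral_mul {L : ℝ} {p : ℕ → L2 L} {D : ℝ} (hD : ∀ k, ‖p k‖ ≤ D) {W : L2 L}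
    (h : ∀ᵐ x ∂intervalMeasure L, Tendsto (fun k => p k x) atTop (𝓝 (W x))) {χ : ℝ → ℝ}
    (hχ : Continuous χ) (hχc : HasCompactSupport χ) :
    Tendsto (fun k => ∫ x in Ioo 0 L, p k x * χ x) atTop (𝓝 (∫ x in Ioo 0 L, W x * χ x)) := by
  obtain ⟨C, hC⟩ := hχc.exists_bound_of_continuous hχ
  have hr : ∀ k, ‖p k - W‖ ≤ D + ‖W‖ := fun k =>
    (norm_sub_le _ _).trans (add_le_add (hD k) le_rfl)
  have hr0 : ∀ᵐ x ∂intervalMeasure L, Tendsto (fun k => (p k - W : L2 L) x) atTop (𝓝 0) := by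
    filter_upwards [h, ae_all_iff.2 fun k => Lp.coeFn_sub (p k) W] with x h1 h2
    simp only [h2, Pi.sub_apply]
    simpa using h1.sub_const (W x)
  have h0 := (L2.tendsto_integral_abs_zero hr hr0).const_mul C
  rw [mul_zero] at h0
  rw [tendsto_iff_dist_tendsto_zero]
  refine squeeze_zero (fun _ => dist_nonneg) (fun k => ?_) h0
  rw [dist_eq_norm, ← integral_sub (L2.integrable_mul _ hχ hχc) (L2.integrable_mul _ hχ hχc),
    ← integral_const_mul]
  refine norm_integral_le_of_norm_le ((L2.integrable (p k - W)).abs.const_mul C) ?_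
  filter_upwards [Lp.coeFn_sub (p k) W] with x hx
  rw [hx, Pi.sub_apply, ← sub_mul, norm_mul, mul_comm]
  exact mul_le_mul_of_nonneg_right (hC x) (abs_nonneg _)

/-- The leading terms converge: coefficients converging almost everywhere against weakly converging
derivatives. -/
theorem tendsto_integral_coefficient_mul_der {L α β α' β' : ℝ} {b : ℕ → ℝ → ℝ} {a : ℝ → ℝ}
    (hb : ∀ k, IsCoefficient L α β (b k)) (ha : IsCoefficient L α' β' a)
    (hlim : ∀ᵐ x ∂intervalMeasure L, Tendsto (fun k => b k x) atTop (𝓝 (a x)))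
    {w : ℕ → H10 L} {u : H10 L} {N : ℝ} (hN : ∀ k, ‖w k‖ ≤ N) (hw : TendstoWeakly w u)
    (Z : L2 L) :
    Tendsto (fun k => ∫ x in Ioo 0 L, b k x * H10.der (w k) x * Z x) atTop
      (𝓝 (∫ x in Ioo 0 L, a x * H10.der u x * Z x)) := by
  have hbZ k : MemLp (fun x => b k x * Z x) 2 (intervalMeasure L) :=
    (Lp.memLp Z).coefficient_mul (hb k)
  have haZ : MemLp (fun x => a x * Z x) 2 (intervalMeasure L) := (Lp.memLp Z).coefficient_mul ha
  let Y : ℕ → L2 L := fun k => (hbZ k).toLp _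
  let Y₀ : L2 L := haZ.toLp _
  have hY k : Y k =ᵐ[intervalMeasure L] fun x => b k x * Z x := MemLp.coeFn_toLp _
  have hY₀ : Y₀ =ᵐ[intervalMeasure L] fun x => a x * Z x := MemLp.coeFn_toLp _
  set A : ℝ := max |α| |β| + max |α'| |β'|
  have hZ2 : Integrable (fun x => Z x * Z x) (intervalMeasure L) :=
    (Lp.memLp Z).integrable_mul (Lp.memLp Z)
  -- Moving the coefficient onto `Z` gives strong convergence of `Y k`, which pairs with the weak
  -- convergence of the derivatives.
  have hsq : Tendsto (fun k => ‖Y k - Y₀‖ ^ 2) atTop (𝓝 0) := by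
    have h1 := tendsto_integral_of_dominated_convergence (μ := intervalMeasure L)
      (F := fun k x => (Y k - Y₀ : L2 L) x * (Y k - Y₀ : L2 L) x) (f := fun _ => 0)
      (fun x => A ^ 2 * (Z x * Z x))
      (fun k => (Lp.aestronglyMeasurable _).mul (Lp.aestronglyMeasurable _))
      (hZ2.const_mul _) (fun k => by
        filter_upwards [Lp.coeFn_sub (Y k) Y₀, hY k, hY₀, (hb k).2, ha.2] with x h1 h2 h3 h4 h5
        rw [h1, Pi.sub_apply, h2, h3, ← sub_mul]
        have h6 : |b k x - a x| ≤ A := (abs_sub _ _).trans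
          (add_le_add (abs_le_max_abs_abs h4.1 h4.2) (abs_le_max_abs_abs h5.1 h5.2))
        have h7 : (b k x - a x) ^ 2 ≤ A ^ 2 := sq_le_sq' (abs_le.1 h6).1 (abs_le.1 h6).2
        rw [Real.norm_eq_abs, abs_mul_self]
        calc (b k x - a x) * Z x * ((b k x - a x) * Z x)
            = (b k x - a x) ^ 2 * (Z x * Z x) := by ring
          _ ≤ A ^ 2 * (Z x * Z x) := mul_le_mul_of_nonneg_right h7 (mul_self_nonneg _)) (by
        filter_upwards [ae_all_iff.2 fun k => Lp.coeFn_sub (Y k) Y₀, ae_all_iff.2 hY, hY₀, hlim]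
          with x h1 h2 h3 h4
        have h5 : Tendsto (fun k => (b k x - a x) * Z x) atTop (𝓝 0) := by
          simpa using (h4.sub_const (a x)).mul_const (Z x)
        have h6 := h5.mul h5
        rw [mul_zero] at h6
        refine h6.congr fun k => ?_
        rw [h1, Pi.sub_apply, h2, h3, ← sub_mul])
    simpa only [L2.integral_mul_self, integral_zero] using h1
  have hnorm : Tendsto (fun k => ‖Y k - Y₀‖) atTop (𝓝 0) := by
    have := hsq.sqrt
    simpa using this
  have hint k : ∫ x in Ioo 0 L, b k x * H10.der (w k) x * Z x
      = inner ℝ (Y k - Y₀) (H10.der (w k)) + inner ℝ Y₀ (H10.der (w k)) := by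
    rw [← inner_add_left, sub_add_cancel, ← L2.integral_mul_eq_inner]
    refine integral_congr_ae ?_
    filter_upwards [hY k] with x hx
    rw [hx]
    ring
  have hint₀ : ∫ x in Ioo 0 L, a x * H10.der u x * Z x = inner ℝ Y₀ (H10.der u) := by
    rw [← L2.integral_mul_eq_inner]
    refine integral_congr_ae ?_
    filter_upwards [hY₀] with x hx
    rw [hx]
    ring
  simp only [hint, hint₀]
  rw [← zero_add (inner ℝ Y₀ (H10.der u))]
  refine Tendsto.add ?_ (H10.tendsto_inner_der hw Y₀)
  refine squeeze_zero_norm (fun k => ?_) (by simpa using hnorm.mul_const N)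
  exact (norm_inner_le_norm _ _).trans (mul_le_mul_of_nonneg_left (hN k) (norm_nonneg _))

/-- Nonlinear terms are bounded in `L²(0, L)` if the fluxes are bounded. -/
theorem exists_norm_nonlinear_le {L α β : ℝ} (hα : 0 < α) (hαβ : α ≤ β) {b : ℕ → ℝ → ℝ}
    (hb : ∀ k, IsCoefficient L α β (b k)) {q : ℕ → L2 L} {G : ℝ} (hq : ∀ k, ‖q k‖ ≤ G)
    {v : ℕ → L2 L} {N : ℝ} (hN : ∀ k, ‖v k‖ ≤ N) {c : ℕ → ℝ} {B : ℝ} (hB : ∀ k, |c k| ≤ B)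
    {p : ℕ → L2 L} (hp : ∀ k, ∀ᵐ x ∂intervalMeasure L, b k x * v k x = c k + p k x + q k x) :
    ∃ D : ℝ, ∀ k, ‖p k‖ ≤ D := by
  have hβ : 0 < β := hα.trans_le hαβ
  let X : L2 L := (memLp_const (1 : ℝ)).toLp _
  have hX : X =ᵐ[intervalMeasure L] fun _ => 1 := MemLp.coeFn_toLp _
  refine ⟨β * N + B * ‖X‖ + G, fun k => ?_⟩
  have hbv : MemLp (fun x => b k x * v k x) 2 (intervalMeasure L) :=
    (Lp.memLp (v k)).coefficient_mul (hb k)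
  let Y : L2 L := hbv.toLp _
  have hY : Y =ᵐ[intervalMeasure L] fun x => b k x * v k x := MemLp.coeFn_toLp _
  have hYn : ‖Y‖ ≤ β * N := by
    refine (Lp.norm_le_mul_norm_of_ae_le_mul (c := β) (g := v k) ?_).trans
      (mul_le_mul_of_nonneg_left (hN k) hβ.le)
    filter_upwards [hY, (hb k).2] with x h1 h2
    rw [h1, norm_mul, Real.norm_eq_abs (b k x), abs_of_pos (hα.trans_le h2.1)]
    exact mul_le_mul_of_nonneg_right h2.2 (norm_nonneg _)
  have hpe : p k = Y - c k • X - q k := by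
    refine Lp.ext ?_
    filter_upwards [Lp.coeFn_sub (Y - c k • X) (q k), Lp.coeFn_sub Y (c k • X),
      Lp.coeFn_smul (c k) X, hX, hY, hp k] with x h1 h2 h3 h4 h5 h6
    rw [h1, Pi.sub_apply, h2, Pi.sub_apply, h3, Pi.smul_apply, h4, h5, h6, smul_eq_mul]
    ring
  rw [hpe]
  refine (norm_sub_le _ _).trans (add_le_add ((norm_sub_le _ _).trans (add_le_add hYn ?_)) (hq k))
  rw [norm_smul]
  exact mul_le_mul_of_nonneg_right (hB k) (norm_nonneg _)

/-! ### The alternative. -/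

/-- For u = 0 the function φ(u) would be +∞ a.e. on a set of positive measure. -/
theorem IsWeakSolution.ne_zero {L : ℝ} (hL : 0 < L) {a : ℝ → ℝ} {g : L2 L} {φ : ℝ → EReal}
    (hφ0 : φ 0 = ⊤) {u : H10 L} (hu : IsWeakSolution L a g φ u) : u ≠ 0 := by
  rintro rfl
  obtain ⟨w, hw, -⟩ := hu
  have : NeBot (ae (intervalMeasure L)) := by
    rw [ae_neBot, ← Measure.measure_univ_ne_zero]
    simp [hL]
  rw [map_zero] at hw
  obtain ⟨x, h1, h2⟩ := (hw.and (Lp.coeFn_zero ℝ 2 (intervalMeasure L))).exists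
  rw [h2, Pi.zero_apply, hφ0] at h1
  exact EReal.coe_ne_top _ h1.symm

/-- A nonzero weak limit of classical weak solutions of approximating problems is a weak solution of
the limit problem, and the nonlinear terms stay bounded in `L²(0, L)`. -/
theorem isWeakSolution_of_tendstoWeakly {L α β α' β' : ℝ} (hL : 0 < L) (hα : 0 < α) (hαβ : α ≤ β)
    {φ : ℝ → EReal} (hφ : IsNonlinearity φ) {f : ℕ → ℝ → ℝ} (hf : ∀ k, Continuous (f k))
    (h : ∀ t, Tendsto (fun p : ℕ × ℝ => (f p.1 p.2 : EReal)) (atTop ×ˢ 𝓝 t) (𝓝 (φ t)))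
    {b : ℕ → ℝ → ℝ} (hb : ∀ k, IsCoefficient L α β (b k)) {a : ℝ → ℝ}
    (ha : IsCoefficient L α' β' a)
    (hlim : ∀ᵐ x ∂intervalMeasure L, Tendsto (fun k => b k x) atTop (𝓝 (a x)))
    {q : ℕ → L2 L} {g : L2 L} {G : ℝ} (hqG : ∀ k, ‖q k‖ ≤ G) (hq : TendstoWeakly q g)
    {w : ℕ → H10 L} (hsol : ∀ k, IsClassicalWeakSolution L (b k) (q k) (f k) (w k)) {u : H10 L}
    (hw : TendstoWeakly w u) (hu : u ≠ 0) :
    IsWeakSolution L a g φ u ∧ ∃ C : ℝ, ∀ k,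
      eLpNorm (fun x => f k (H10.val (w k) x)) 2 (intervalMeasure L) ≤ ENNReal.ofReal C := by
  have hN : ∀ k, ‖w k‖ ≤ G / α := fun k => ((hsol k).norm_der_le hL hα (hb k) (hf k)).trans
    (div_le_div_of_nonneg_right (hqG k) hα.le)
  choose c hc using fun k => (hsol k).exists_flux_eq hL (hb k) (hf k)
  obtain ⟨B, hB⟩ := exists_abs_flux_le hL hα hαβ hφ h hb hqG hN hc hu hw
  have hm k : MemLp (fun x => f k (H10.val (w k) x)) 2 (intervalMeasure L) :=
    H10.memLp_comp_val hL (w k) (hf k) 2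
  let p : ℕ → L2 L := fun k => (hm k).toLp _
  have hp k : p k =ᵐ[intervalMeasure L] fun x => f k (H10.val (w k) x) := MemLp.coeFn_toLp _
  obtain ⟨D, hD⟩ := exists_norm_nonlinear_le hα hαβ hb hqG hN hB (p := p) fun k => by
    filter_upwards [hc k, hp k] with x h1 h2
    rw [h1, h2]
  constructor
  · obtain ⟨W, hW, hpW⟩ := L2.exists_ae_tendsto hD (q := fun x => φ (H10.val u x))
      (fun x => hφ.ne_bot _) (by
        filter_upwards [ae_all_iff.2 hp, ae_all_iff.2 fun k => H10.val_ae_eq_rep hL (w k),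
          H10.val_ae_eq_rep hL u, ae_restrict_mem measurableSet_Ioo] with x h1 h2 h3 h4
        simp only [h1, h2, h3]
        exact (h (H10.rep u x)).comp
          (tendsto_id.prodMk (H10.tendsto_rep hw (Ioo_subset_Icc_self h4))))
    refine ⟨W, hW, fun ψ => ?_⟩
    have hψ := testFunction_continuous_deriv ψ
    have hψc := ψ.hasCompactSupport.deriv
    have hZm : MemLp (deriv ψ) 2 (intervalMeasure L) := memLp_of_continuousOn_Icc hψ.continuousOn 2
    let Z : L2 L := hZm.toLp _
    have hZ : Z =ᵐ[intervalMeasure L] deriv ψ := MemLp.coeFn_toLp _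
    -- Only the derivative of a test function enters the equation, so any `z` with z' = ψ' may be
    -- used; it exists since ψ' has mean value zero.
    obtain ⟨z, hz⟩ := H10.exists_der_eq hL.le Z (by
      rw [integral_congr_ae hZ, H10.integral_deriv_testFunction hL.le])
    have hcongr (F : ℝ → ℝ) : ∫ x in Ioo 0 L, F x * Z x = ∫ x in Ioo 0 L, F x * deriv ψ x := by
      refine integral_congr_ae ?_
      filter_upwards [hZ] with x hx
      rw [hx]
    have h1 := tendsto_integral_coefficient_mul_der hb ha hlim hN hw Z
    have h2 := L2.tendsto_integral_mul hD hpW hψ hψc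
    have h3 : Tendsto (fun k => ∫ x in Ioo 0 L, q k x * deriv ψ x) atTop
        (𝓝 (∫ x in Ioo 0 L, g x * deriv ψ x)) := by
      have := hq.tendsto_apply (innerSL ℝ Z)
      simp only [innerSL_apply_apply, real_inner_comm _ Z, ← L2.integral_mul_eq_inner,
        hcongr] at this
      exact this
    rw [hcongr] at h1
    refine tendsto_nhds_unique h1 ((h2.add h3).congr fun k => ?_)
    have h4 := hsol k z
    rw [hz, hcongr (fun x => q k x)] at h4
    rw [h4]
    congr 1
    refine integral_congr_ae ?_
    filter_upwards [hp k, hZ] with x h5 h6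
    rw [h5, h6]
  · refine ⟨D, fun k => ?_⟩
    rw [← eLpNorm_congr_ae (hp k), ← ENNReal.ofReal_toReal (Lp.eLpNorm_ne_top (p k)),
      ← Lp.norm_def]
    exact ENNReal.ofReal_le_ofReal (hD k)

theorem mainTheorem1 (L : ℝ) (hL : 0 < L)
    (a : ℝ → ℝ) (ha : ∃ α' β' : ℝ, 0 < α' ∧ α' < β' ∧ IsCoefficient L α' β' a)
    (g : L2 L)
    (φ : ℝ → EReal) (hφ : IsNonlinearity φ) (hφ0 : φ 0 = ⊤)
    (α β : ℝ) (hα : 0 < α) (hαβ : α < β)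
    (an : ℕ → ℝ → ℝ) (han : ∀ n, IsCoefficient L α β (an n))
    (hlim : ∀ᵐ x ∂intervalMeasure L, Tendsto (fun n => an n x) atTop (𝓝 (a x)))
    (gn : ℕ → L2 L) (c₀ : ℝ) (hc₀ : 0 < c₀) (hgn : ∀ n, ‖gn n‖ ≤ c₀)
    (hg : TendstoWeakly gn g)
    (φn : ℕ → ℝ → ℝ) (hφn : ∀ n, Continuous (φn n))
    (happ : IsReasonableApprox φ (fun n s => (φn n s : EReal))) :
    (∀ n, ∃ u : H10 L, IsClassicalWeakSolution L (an n) (gn n) (φn n) u) ∧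
    (∀ n, ∀ u : H10 L, IsClassicalWeakSolution L (an n) (gn n) (φn n) u →
      ‖H10.der u‖ ≤ ‖gn n‖ / α ∧ ‖gn n‖ / α ≤ c₀ / α) ∧
    (∀ un : ℕ → H10 L, (∀ n, IsClassicalWeakSolution L (an n) (gn n) (φn n) (un n)) →
      ∀ ns : ℕ → ℕ, StrictMono ns →
      ∀ u : H10 L, TendstoWeakly (fun k => un (ns k)) u →
        (u = 0 ∨ IsWeakSolution L a g φ u) ∧
        ¬ (u = 0 ∧ IsWeakSolution L a g φ u) ∧
        (u ≠ 0 → ∃ C : ℝ, ∀ k,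
          eLpNorm (fun x => φn (ns k) (H10.val (un (ns k)) x)) 2 (intervalMeasure L)
            ≤ ENNReal.ofReal C)) := by
  refine ⟨fun n => exists_isClassicalWeakSolution hL hα hαβ.le (han n) (gn n) (hφn n),
    fun n u hu => ⟨hu.norm_der_le hL hα (han n) (hφn n),
      div_le_div_of_nonneg_right (hgn n) hα.le⟩, fun un hun ns hns u hu => ?_⟩
  obtain ⟨α', β', -, -, ha⟩ := ha
  have key : u ≠ 0 → _ := isWeakSolution_of_tendstoWeakly hL hα hαβ.le hφ
    (f := fun k => φn (ns k)) (fun k => hφn (ns k))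
    (fun t => (happ.tendsto_prod t).comp (hns.tendsto_atTop.prodMap tendsto_id))
    (fun k => han (ns k)) ha (hlim.mono fun x hx => hx.comp hns.tendsto_atTop)
    (fun k => hgn (ns k)) (hg.comp hns.tendsto_atTop) (fun k => hun (ns k)) hu
  refine ⟨?_, fun h => h.2.ne_zero hL hφ0 h.1, fun h => (key h).2⟩
  rcases eq_or_ne u 0 with h | h
  · exact Or.inl h
  · exact Or.inr (key h).1
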